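/- **Setting.** Let $X=[\alpha,\beta]$ with $\alpha<\beta$, let $T:X\to X$ be a Borel measurable map and let $\mathcal P=\{I_k\}_k$ be an at most countable family of pairwise disjoint nondegenerate intervals contained in $X$ (the partition). The repeller is $\Lambda=\{x\in X: T^n x\in\bigcup_k I_k \text{ for all } n\ge 0\}$. An $n$-cylinder is a set $\{x\in X: T^ix\in I_{w_i},\ 0\le i<n\}$; for $x\in\Lambda$, $C_n(x)$ is the $n$-cylinder containing $x$. For $x,y\in\Lambda$ let $x\wedge y$ be the least $n\ge0$ for which $T^nx,T^ny$ lie in different elements of $\mathcal P$ (with $x\wedge y=\infty$ if there is none), and $d_\theta(x,y)=\theta^{x\wedge y}$ for $\theta\in(0,1)$ (with $\theta^\infty=0$). Assume that $T$ is a *Gibbs–Markov interval map*, that is: * $T$ is differentiable on each $I_k$ (one-sidedly at endpoints of $I_k$ that belong to $I_k$), and there is $\gamma>0$ with $|DT|>\gamma$ on every $I_k$; * (bounded distortion) there is $C_{bd}>0$ with $C_{bd}^{-1}\le DT^n(x)/DT^n(y)\le C_{bd}$ for all $n$ and all $x,y$ in the same $n$-cylinder; * (Markov property) $T$ is injective on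 each $I_k$, and $T(I_j)\cap I_k\neq\emptyset$ implies $I_k\subseteq T(I_j)$; * there is $\theta\in(0,1)$ such that, for each $k$, $\log g$ with $g=1/|DT|$ is Lipschitz on $I_k\cap\Lambda$ with respect to $d_\theta$; * (big images) there is $\delta_0>0$ such that $|T^n(C)|\ge\delta_0$ for all $n\ge1$ and all nonempty $n$-cylinders $C$ if $\mathcal P$ is infinite, and $|I_k|\ge\delta_0$ for all $k$ if $\mathcal P$ is finite ($|\cdot|$ is Lebesgue measure). Let $\varphi:\Lambda\to\mathbb R$ be locally Hölder: there are $M>0$, $\zeta\in(0,1)$ with $|\varphi(x)-\varphi(y)|\le M\zeta^n$ whenever $n\ge1$ and $x,y\in\Lambda$ lie in the same $n$-cylinder. Let $\mu$ be a $T$-invariant Borel probability measure with $\mu(\Lambda)=1$ that is Gibbs for $\varphi$: there are $c_\varphi>0$ and $P\in\mathbb R$ such that, for all $n$ and all $x\in\Lambda$, $$c_\varphi^{-1}\le\frac{\mu(C_n(x))}{\exp\left(-nP+\sum_{i=0}^{n-1}\varphi(T^ix)\right)}\le c_\varphi .$$ Assume finally that $(T,\mu)$ is mixing: $\mu(A\cap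 T^{-n}B)\to\mu(A)\mu(B)$ for all Borel sets $A,B$. **Claim.** $(T,\mu)$ is exponentially $4$-mixing. There is $c_1'>0$ with the following two properties. 1. For all $f_1,f_2:X\to\mathbb R$ of bounded variation and all $g_1,g_2\in L^\infty(\mu)$ there is $C_1'>0$, depending on $f_1,f_2,g_1,g_2$, such that for all $a<b\le c$ in $\mathbb N$ $$\left|\int f_1\cdot f_2\circ T^a\cdot g_1\circ T^b\cdot g_2\circ T^c\,d\mu-\int f_1\cdot f_2\circ T^a\,d\mu\int g_1\cdot g_2\circ T^{c-b}\,d\mu\right|\le C_1'e^{-c_1'(b-a)}.$$ 2. There is a single $C_1'>0$ for which this inequality holds for all $a<b\le c$ in $\mathbb N$, all $r>0$, all $x,y\in X$ and $f_1=g_1=\mathbb 1_{B(x,2r)}$, $f_2=g_2=\mathbb 1_{B(y,2r)}$. In particular, for any covers $X\subseteq\bigcup_{p=1}^{k(r)}B(x^r_p,r)$ with centres in $X$, the constant for $f_1=g_1=\mathbb 1_{B(x^r_p,2r)}$, $f_2=g_2=\mathbb 1_{B(x^r_q,2r)}$ does not depend on $r$, $p$ or $q$. -/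

import Mathlib

/-!
Interval maps on `X = [α, β]` with a countable Markov partition `I : ι → Set ℝ`. A map of `X` is given
by `T : ℝ → ℝ` preserving `X`; its values off `X` play no role.
-/

namespace IntervalMap

/-- The repeller: the points of `X = [α, β]` whose whole orbit stays in the union of the partition
elements. -/
def repeller {ι : Type*} (α β : ℝ) (T : ℝ → ℝ) (I : ι → Set ℝ) : Set ℝ :=
  {x | x ∈ Set.Icc α β ∧ ∀ n : ℕ, ∃ k, T^[n] x ∈ I k}

/-- The `n`-cylinder `[w₀, …, w_{n-1}] = ⋂_{i<n} T⁻ⁱ I_{w_i}` of a word `w` of length `n`. -/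
def cylinder {ι : Type*} (α β : ℝ) (T : ℝ → ℝ) (I : ι → Set ℝ) {n : ℕ} (w : Fin n → ι) : Set ℝ :=
  {x | x ∈ Set.Icc α β ∧ ∀ i : Fin n, T^[i] x ∈ I (w i)}

/-- The `i`-th symbols of `x` and `y` exist and agree: `Tⁱ x` and `Tⁱ y` lie in the same element. -/
def SameSymbol {ι : Type*} (T : ℝ → ℝ) (I : ι → Set ℝ) (i : ℕ) (x y : ℝ) : Prop :=
  ∃ k, T^[i] x ∈ I k ∧ T^[i] y ∈ I k

/-- The `n`-cylinder `C_n(x)` containing `x` (for `x` in the repeller). -/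
def cylinderAt {ι : Type*} (α β : ℝ) (T : ℝ → ℝ) (I : ι → Set ℝ) (n : ℕ) (x : ℝ) : Set ℝ :=
  {y | y ∈ Set.Icc α β ∧ ∀ i < n, SameSymbol T I i x y}

open Classical in
/-- The symbolic metric `θ ^ (x ∧ y)` on the repeller, where `x ∧ y` is the first index at which the
itineraries of `x` and `y` differ; it is `0` when the itineraries coincide. -/
noncomputable def symDist {ι : Type*} (T : ℝ → ℝ) (I : ι → Set ℝ) (θ x y : ℝ) : ℝ :=
  if ∀ i, SameSymbol T I i x y then 0 else θ ^ sInf {i : ℕ | ¬ SameSymbol T I i x y}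

/-- The weight `g = dm / d(m ∘ T) = 1 / |T'|` on the partition element `P`. At an endpoint belonging
to `P` the derivative is one-sided. -/
noncomputable def weight (T : ℝ → ℝ) (P : Set ℝ) (x : ℝ) : ℝ := |derivWithin T P x|⁻¹

/-- Piecewise expanding interval maps with bounded distortion. Partition elements are nondegenerate
intervals, with or without their endpoints. That they cover `X` is only asked modulo the measure under
consideration, see `IsGibbsMeasure`. -/
structure IsPiecewiseExpanding {ι : Type*} (α β : ℝ) (T : ℝ → ℝ) (I : ι → Set ℝ) : Prop where
  mapsTo : Set.MapsTo T (Set.Icc α β) (Set.Icc α β)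
  subset : ∀ k, I k ⊆ Set.Icc α β
  interval : ∀ k, (I k).OrdConnected
  nondegenerate : ∀ k, (interior (I k)).Nonempty
  disjoint : Pairwise fun j k => Disjoint (I j) (I k)
  differentiable : ∀ k, DifferentiableOn ℝ T (I k)
  deriv_bound : ∃ γ > 0, ∀ k, ∀ x ∈ I k, γ < |derivWithin T (I k) x|
  distortion : ∃ C > 0, ∀ (n : ℕ) (w : Fin n → ι),
    ∀ x ∈ cylinder α β T I w, ∀ y ∈ cylinder α β T I w,
      C⁻¹ ≤ derivWithin T^[n] (cylinder α β T I w) x / derivWithin T^[n] (cylinder α β T I w) y ∧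
      derivWithin T^[n] (cylinder α β T I w) x / derivWithin T^[n] (cylinder α β T I w) y ≤ C

/-- Gibbs–Markov interval maps. -/
structure IsGibbsMarkov {ι : Type*} (α β : ℝ) (T : ℝ → ℝ) (I : ι → Set ℝ) : Prop
    extends IsPiecewiseExpanding α β T I where
  injective : ∀ k, Set.InjOn T (I k)
  /-- Each image `T (I j)` is a union of partition elements (up to points outside all of them). -/
  markov : ∀ j k, (T '' I j ∩ I k).Nonempty → I k ⊆ T '' I j
  /-- `log g` is Lipschitz on each partition element for the symbolic metric. -/
  log_weight_lipschitz : ∃ θ : ℝ, 0 < θ ∧ θ < 1 ∧ ∀ k, ∃ L : ℝ,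
    ∀ x ∈ I k ∩ repeller α β T I, ∀ y ∈ I k ∩ repeller α β T I,
      |Real.log (weight T (I k) x) - Real.log (weight T (I k) y)| ≤ L * symDist T I θ x y
  /-- Big images; `δ` bounds lengths (Lebesgue measures) from below. -/
  big_image : ∃ δ : ℝ, 0 < δ ∧
    (Infinite ι → ∀ (n : ℕ), 1 ≤ n → ∀ w : Fin n → ι, (cylinder α β T I w).Nonempty →
      ENNReal.ofReal δ ≤ MeasureTheory.volume (T^[n] '' cylinder α β T I w)) ∧
    (Finite ι → ∀ k, ENNReal.ofReal δ ≤ MeasureTheory.volume (I k))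

/-- Locally Hölder potentials: `var_n φ ≤ M ζⁿ` for all `n ≥ 1`, where `var_n φ` is the largest
oscillation of `φ` between points of the repeller with the same first `n` symbols. -/
def IsLocallyHolder {ι : Type*} (α β : ℝ) (T : ℝ → ℝ) (I : ι → Set ℝ) (φ : ℝ → ℝ) : Prop :=
  ∃ M > 0, ∃ ζ : ℝ, 0 < ζ ∧ ζ < 1 ∧ ∀ n : ℕ, 1 ≤ n →
    ∀ x ∈ repeller α β T I, ∀ y ∈ repeller α β T I,
      (∀ i < n, SameSymbol T I i x y) → |φ x - φ y| ≤ M * ζ ^ n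

/-- `μ` is a Gibbs measure for the potential `φ`: it is `T`-invariant, is carried by the repeller, and
the cylinders satisfy the Gibbs inequality. -/
structure IsGibbsMeasure {ι : Type*} (α β : ℝ) (T : ℝ → ℝ) (I : ι → Set ℝ) (φ : ℝ → ℝ)
    (μ : MeasureTheory.Measure ℝ) : Prop where
  invariant : MeasureTheory.MeasurePreserving T μ μ
  carried : ∀ᵐ x ∂μ, x ∈ repeller α β T I
  gibbs : ∃ c > 0, ∃ p : ℝ, ∀ n : ℕ, ∀ x ∈ repeller α β T I,
    c⁻¹ ≤ μ.real (cylinderAt α β T I n x) / Real.exp (-(n * p) + birkhoffSum T φ n x) ∧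
    μ.real (cylinderAt α β T I n x) / Real.exp (-(n * p) + birkhoffSum T φ n x) ≤ c

/-- The system `(T, μ)` is (strongly) mixing. -/
def IsMixing (T : ℝ → ℝ) (μ : MeasureTheory.Measure ℝ) : Prop :=
  ∀ A B : Set ℝ, MeasurableSet A → MeasurableSet B →
    Filter.Tendsto (fun n : ℕ => μ (A ∩ T^[n] ⁻¹' B)) Filter.atTop (nhds (μ A * μ B))

/-- `|∫ f₁ · f₂∘Tᵃ · g₁∘Tᵇ · g₂∘Tᶜ dμ - ∫ f₁ · f₂∘Tᵃ dμ ∫ g₁ · g₂∘Tᶜ⁻ᵇ dμ|`, used for `b ≤ c`. -/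
noncomputable def fourCorrelation (T : ℝ → ℝ) (μ : MeasureTheory.Measure ℝ)
    (f₁ f₂ g₁ g₂ : ℝ → ℝ) (a b c : ℕ) : ℝ :=
  |(∫ x, f₁ x * f₂ (T^[a] x) * g₁ (T^[b] x) * g₂ (T^[c] x) ∂μ)
    - (∫ x, f₁ x * f₂ (T^[a] x) ∂μ) * ∫ x, g₁ x * g₂ (T^[c - b] x) ∂μ|

/-- The indicator function of the open ball `B(x, 2r)`. -/
noncomputable def ballIndicator (x r : ℝ) : ℝ → ℝ :=
  (Metric.ball x (2 * r)).indicator fun _ => 1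

end IntervalMap

/-! The core is one-sided exponential ψ-mixing: writing `m w` for the measure of the cylinder of a
word w, the sum of m(u v w) over all words v of length n is at most (1 + Bρⁿ) m(u) m(w), uniformly
in u and w (`IsMixing.exists_push_le`, `exists_measure_cyl_inter_le`).

The Gibbs inequality determines m only up to a constant factor, which is too weak for decay of
correlations. `IsMixing.relHolder` improves it. The Gibbs weights have Hölder ratios by the Markov
property; their asymptotic version ν keeps this regularity and is comparable to m. At a word u where
ν/m is almost maximal, ν is almost a multiple of m on all extensions of u, and mixing carries this
information from u to arbitrary words. Hence m(u·)/m is log-Hölder, uniformly in u.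

Then comes a Doeblin argument. Finitely many symbols carry half of every extension, so mixing on
finitely many pairs gives a uniform minorization (`IsMixing.exists_le_push`). Weights with Hölder
density form a class that survives pushing forward and splitting off a fixed proportion of m; the
mass of the remainder decreases geometrically.

For functions, cylinders are intervals of exponentially small measure, unless one partition element
has full mass; in that case μ is a Dirac mass at a fixed point and the correlation vanishes. A
function of variation V is within V · max μ(C) in L¹ of a function constant on cylinders. Half of
the gap b − a is spent on this approximation and half on mixing, so f₁ · f₂∘Tᵃ decorrelates from
G∘Tᵇ for every bounded G, in particular for G = g₁ · g₂∘Tᶜ⁻ᵇ. The constants depend only on sup norms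
and variations, and the variation of a ball indicator is at most 2, which gives the uniform
statement. -/

open Filter Topology
open scoped ENNReal

/-! ### Sums of weights over words -/

namespace WordWeight

variable {ι : Type*}

/-- The sum of `F` over the words of length `n`. -/
noncomputable def wsum : ℕ → (List ι → ℝ≥0∞) → ℝ≥0∞
  | 0, F => F []
  | n + 1, F => ∑' a, wsum n fun v => F (a :: v)

theorem wsum_mono {F G : List ι → ℝ≥0∞} {n : ℕ} (h : ∀ v, v.length = n → F v ≤ G v) :
    wsum n F ≤ wsum n G := by
  induction n generalizing F G with
  | zero => exact h [] rfl
  | succ n ih => exact ENNReal.tsum_le_tsum fun a => ih fun v hv => h _ (by simp [hv])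

theorem wsum_congr {F G : List ι → ℝ≥0∞} {n : ℕ} (h : ∀ v, v.length = n → F v = G v) :
    wsum n F = wsum n G :=
  le_antisymm (wsum_mono fun v hv => (h v hv).le) (wsum_mono fun v hv => (h v hv).ge)

theorem wsum_tsum {κ : Type*} (F : κ → List ι → ℝ≥0∞) (n : ℕ) :
    wsum n (fun v => ∑' k, F k v) = ∑' k, wsum n (F k) := by
  induction n generalizing F with
  | zero => rfl
  | succ n ih =>
    simp only [wsum]
    rw [ENNReal.tsum_comm]
    exact tsum_congr fun a => ih fun k v => F k (a :: v)

theorem wsum_add (F G : List ι → ℝ≥0∞) (n : ℕ) :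
    wsum n (fun v => F v + G v) = wsum n F + wsum n G := by
  induction n generalizing F G with
  | zero => rfl
  | succ n ih =>
    simp only [wsum]
    rw [← ENNReal.tsum_add]
    exact tsum_congr fun a => ih _ _

theorem wsum_const_mul (c : ℝ≥0∞) (F : List ι → ℝ≥0∞) (n : ℕ) :
    wsum n (fun v => c * F v) = c * wsum n F := by
  induction n generalizing F with
  | zero => rfl
  | succ n ih =>
    simp only [wsum]
    rw [← ENNReal.tsum_mul_left]
    exact tsum_congr fun a => ih _

theorem wsum_mul_const (c : ℝ≥0∞) (F : List ι → ℝ≥0∞) (n : ℕ) :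
    wsum n (fun v => F v * c) = wsum n F * c := by
  simpa only [mul_comm] using wsum_const_mul c F n

theorem wsum_append (F : List ι → ℝ≥0∞) (n k : ℕ) :
    wsum (n + k) F = wsum n fun u => wsum k fun v => F (u ++ v) := by
  induction n generalizing F with
  | zero => simp [wsum]
  | succ n ih =>
    rw [Nat.succ_add]
    simp only [wsum, List.cons_append]
    exact tsum_congr fun a => ih _

theorem wsum_succ_right (F : List ι → ℝ≥0∞) (n : ℕ) :
    wsum (n + 1) F = ∑' a, wsum n fun v => F (v ++ [a]) := by
  rw [wsum_append, ← wsum_tsum]; rfl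

theorem le_wsum (F : List ι → ℝ≥0∞) (w : List ι) : F w ≤ wsum w.length F := by
  induction w generalizing F with
  | nil => exact le_rfl
  | cons a w ih =>
    simp only [wsum, List.length_cons]
    exact (ih fun v => F (a :: v)).trans
      (ENNReal.le_tsum (f := fun a => wsum w.length fun v => F (a :: v)) a)

/-- A pointwise deficit is at most the total deficit. -/
theorem add_wsum_le {F G : List ι → ℝ≥0∞} {w : List ι} (h : ∀ v, F v ≤ G v) :
    G w + wsum w.length F ≤ F w + wsum w.length G := by
  have key : wsum w.length G = wsum w.length F + wsum w.length fun v => G v - F v := by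
    rw [← wsum_add]; exact wsum_congr fun v _ => (add_tsub_cancel_of_le (h v)).symm
  rw [key]
  have := le_wsum (fun v => G v - F v) w
  calc G w + wsum w.length F = F w + (G w - F w) + wsum w.length F := by
        rw [add_tsub_cancel_of_le (h w)]
    _ ≤ F w + (wsum w.length fun v => G v - F v) + wsum w.length F := by gcongr
    _ = _ := by ring

/-! ### Weights with Hölder ratios -/

/-- The distortion constant `exp (K ζᵏ)`. -/
noncomputable def distortionFactor (ζ K : ℝ) (k : ℕ) : ℝ≥0∞ := ENNReal.ofReal (Real.exp (K * ζ ^ k))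

theorem distortionFactor_ne_top {ζ K : ℝ} {k : ℕ} : distortionFactor ζ K k ≠ ∞ :=
  ENNReal.ofReal_ne_top

theorem distortionFactor_ne_zero {ζ K : ℝ} {k : ℕ} : distortionFactor ζ K k ≠ 0 := by
  simp [distortionFactor, Real.exp_pos]

theorem distortionFactor_mul (ζ K L : ℝ) (k : ℕ) :
    distortionFactor ζ K k * distortionFactor ζ L k = distortionFactor ζ (K + L) k := by
  rw [distortionFactor, distortionFactor, ← ENNReal.ofReal_mul (Real.exp_pos _).le, ← Real.exp_add,
    ← add_mul]; rfl

theorem distortionFactor_mono {ζ K L : ℝ} {k l : ℕ} (h : K * ζ ^ k ≤ L * ζ ^ l) :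
    distortionFactor ζ K k ≤ distortionFactor ζ L l :=
  ENNReal.ofReal_le_ofReal (Real.exp_le_exp.2 h)

/-- The ratio of `f` and `g` is locally Hölder in logarithmic scale. -/
def RelHolder (ζ K : ℝ) (f g : List ι → ℝ≥0∞) : Prop :=
  ∀ w z z' : List ι, w ≠ [] →
    f (w ++ z) * g (w ++ z') ≤ distortionFactor ζ K w.length * (f (w ++ z') * g (w ++ z))

/-- The defining inequality is bilinear in f and g, so it may be summed over the continuations of z
and of z' separately. The two lengths are independent because two limits will be taken one after the
other. -/
theorem RelHolder.wsum_le {ζ K : ℝ} {f g : List ι → ℝ≥0∞} (h : RelHolder ζ K f g) (n k : ℕ)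
    {w : List ι} (hw : w ≠ []) (z z' : List ι) :
    (wsum n fun v => f (w ++ z ++ v)) * (wsum k fun v => g (w ++ z' ++ v)) ≤
      distortionFactor ζ K w.length *
        ((wsum k fun v => f (w ++ z' ++ v)) * (wsum n fun v => g (w ++ z ++ v))) := by
  rw [← wsum_mul_const, ← wsum_const_mul, ← wsum_const_mul]
  refine wsum_mono fun v _ => ?_
  rw [← wsum_const_mul, ← wsum_mul_const, ← wsum_const_mul]
  refine wsum_mono fun v' _ => ?_
  simpa only [List.append_assoc] using h w (z ++ v) (z' ++ v') hw

/-! ### The asymptotic weight of a word -/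

/-- The upper limit of the total weights of the extensions of a word by `n` letters. -/
noncomputable def extensionLimsup (q : List ι → ℝ≥0∞) (w : List ι) : ℝ≥0∞ :=
  limsup (fun n => wsum n fun v => q (w ++ v)) atTop

/-- Consistency of a weight under extension of words on the right. -/
def IsConsistent (m : List ι → ℝ≥0∞) : Prop := ∀ w, ∑' a, m (w ++ [a]) = m w

theorem IsConsistent.wsum {m : List ι → ℝ≥0∞} (h : IsConsistent m) (n : ℕ) (w : List ι) :
    (wsum n fun v => m (w ++ v)) = m w := by
  induction n generalizing w with
  | zero => simp [WordWeight.wsum]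
  | succ n ih =>
    rw [← h w]
    simp only [WordWeight.wsum]
    exact tsum_congr fun a => by simpa using ih (w ++ [a])

theorem IsConsistent.append_le {m : List ι → ℝ≥0∞} (h : IsConsistent m) (u v : List ι) :
    m (u ++ v) ≤ m u :=
  (le_wsum (fun v => m (u ++ v)) v).trans_eq (h.wsum _ _)

theorem extensionLimsup_le {m q : List ι → ℝ≥0∞} {c : ℝ≥0∞} (hm : IsConsistent m)
    (hq : ∀ w, q w ≤ c * m w) (w : List ι) : extensionLimsup q w ≤ c * m w := by
  refine limsup_le_of_le (by isBoundedDefault) (Eventually.of_forall fun n => ?_)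
  calc _ ≤ WordWeight.wsum n fun v => c * m (w ++ v) := wsum_mono fun v _ => hq _
    _ = c * m w := by rw [wsum_const_mul, hm.wsum]

theorem le_extensionLimsup {m q : List ι → ℝ≥0∞} {c : ℝ≥0∞} (hm : IsConsistent m)
    (hq : ∀ w, m w ≤ c * q w) (hc : c ≠ ∞) (w : List ι) : m w ≤ c * extensionLimsup q w := by
  rw [extensionLimsup, ← ENNReal.limsup_const_mul_of_ne_top hc]
  refine le_limsup_of_frequently_le (Eventually.frequently (Eventually.of_forall fun n => ?_))
    (by isBoundedDefault)
  calc m w = WordWeight.wsum n fun v => m (w ++ v) := (hm.wsum n w).symm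
    _ ≤ WordWeight.wsum n fun v => c * q (w ++ v) := wsum_mono fun v _ => hq _
    _ = _ := wsum_const_mul _ _ _

/-- Reverse Fatou for counting measure on the letters, with the summable majorant c · m(w a). The
limsup is consistent only in this one direction, which is the one that `mul_push_le` needs. -/
theorem extensionLimsup_le_tsum {m q : List ι → ℝ≥0∞} {c : ℝ≥0∞} (hm : IsConsistent m)
    (hq : ∀ w, q w ≤ c * m w) (hc : c ≠ ∞) (hm' : ∀ w, m w ≠ ∞) (w : List ι) :
    extensionLimsup q w ≤ ∑' a, extensionLimsup q (w ++ [a]) := by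
  let _ : MeasurableSpace ι := ⊤
  have h := MeasureTheory.limsup_lintegral_le (μ := MeasureTheory.Measure.count)
    (f := fun n (a : ι) => wsum n fun v => q (w ++ [a] ++ v)) (fun a => c * m (w ++ [a]))
    (fun n => measurable_from_top) (fun n => Eventually.of_forall fun a => by
      calc _ ≤ WordWeight.wsum n fun v => c * m (w ++ [a] ++ v) := wsum_mono fun v _ => hq _
        _ = c * m (w ++ [a]) := by rw [wsum_const_mul, hm.wsum])
    (by rw [MeasureTheory.lintegral_count, ENNReal.tsum_mul_left, hm w]
        exact ENNReal.mul_ne_top hc (hm' w))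
  simp only [MeasureTheory.lintegral_count] at h
  refine le_trans (le_of_eq ?_) h
  rw [extensionLimsup, ← limsup_nat_add _ 1]
  congr 1
  funext n
  simp [wsum]

theorem extensionLimsup_le_wsum {m q : List ι → ℝ≥0∞} {c : ℝ≥0∞} (hm : IsConsistent m)
    (hq : ∀ w, q w ≤ c * m w) (hc : c ≠ ∞) (hm' : ∀ w, m w ≠ ∞) (n : ℕ) (w : List ι) :
    extensionLimsup q w ≤ wsum n fun v => extensionLimsup q (w ++ v) := by
  induction n generalizing w with
  | zero => simp [wsum]
  | succ n ih =>
    refine (extensionLimsup_le_tsum hm hq hc hm' w).trans ?_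
    simp only [wsum]
    exact ENNReal.tsum_le_tsum fun a => by simpa using ih (w ++ [a])

/-- A limsup of products is not the product of the limsups, so the limits are taken in turn: n → ∞
with k fixed, then k → ∞. Finiteness allows the fixed factors to move through the limsup. -/
theorem RelHolder.extensionLimsup {ζ K : ℝ} {f g : List ι → ℝ≥0∞} (h : RelHolder ζ K f g)
    (hf : ∀ w n, (WordWeight.wsum n fun v => f (w ++ v)) ≠ ∞)
    (hg : ∀ w n, (WordWeight.wsum n fun v => g (w ++ v)) ≠ ∞)
    (hf' : ∀ w, WordWeight.extensionLimsup f w ≠ ∞) (hg' : ∀ w, WordWeight.extensionLimsup g w ≠ ∞) :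
    RelHolder ζ K (WordWeight.extensionLimsup f) (WordWeight.extensionLimsup g) := by
  intro w z z' hw
  set d := distortionFactor ζ K w.length
  have step (k : ℕ) : WordWeight.extensionLimsup f (w ++ z) * (WordWeight.wsum k fun v => g (w ++ z' ++ v)) ≤
      d * ((WordWeight.wsum k fun v => f (w ++ z' ++ v)) * WordWeight.extensionLimsup g (w ++ z)) := by
    rw [mul_comm, ← mul_assoc, WordWeight.extensionLimsup, WordWeight.extensionLimsup,
      ← ENNReal.limsup_const_mul_of_ne_top (hg _ _),
      ← ENNReal.limsup_const_mul_of_ne_top (ENNReal.mul_ne_top distortionFactor_ne_top (hf _ _))]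
    refine limsup_le_limsup (Eventually.of_forall fun n => ?_) (by isBoundedDefault)
      (by isBoundedDefault)
    simpa only [mul_comm, mul_assoc, mul_left_comm] using h.wsum_le n k hw z z'
  rw [WordWeight.extensionLimsup.eq_1 g (w ++ z'), WordWeight.extensionLimsup.eq_1 f (w ++ z'),
    ← ENNReal.limsup_const_mul_of_ne_top (hf' _), mul_comm (limsup _ _), ← mul_assoc,
    ← ENNReal.limsup_const_mul_of_ne_top (ENNReal.mul_ne_top distortionFactor_ne_top (hg' _))]
  refine limsup_le_limsup (Eventually.of_forall fun k => ?_) (by isBoundedDefault)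
      (by isBoundedDefault)
  simpa only [mul_comm, mul_assoc, mul_left_comm] using step k

/-! ### Pushing weights forward; regularity of a mixing weight -/

theorem wsum_comm (F : List ι → List ι → ℝ≥0∞) (n k : ℕ) :
    (wsum n fun v => wsum k fun w => F v w) = wsum k fun w => wsum n fun v => F v w := by
  induction n generalizing F with
  | zero => rfl
  | succ n ih =>
    simp only [wsum]
    rw [wsum_tsum]
    exact tsum_congr fun a => ih _

/-- The total weight of the words `v ++ w` with `v` of length `n`. -/
noncomputable def push (n : ℕ) (l : List ι → ℝ≥0∞) (w : List ι) : ℝ≥0∞ := wsum n fun v => l (v ++ w)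

theorem push_zero (l : List ι → ℝ≥0∞) : push 0 l = l := rfl

theorem push_push (n k : ℕ) (l : List ι → ℝ≥0∞) : push n (push k l) = push (k + n) l := by
  funext w
  simp only [push]
  rw [wsum_append, wsum_comm]
  simp

theorem push_one (l : List ι → ℝ≥0∞) (w : List ι) : push 1 l w = ∑' a, l (a :: w) := rfl

theorem push_succ (n : ℕ) (l : List ι → ℝ≥0∞) (w : List ι) :
    push (n + 1) l w = ∑' a, push n (fun v => l (a :: v)) w := rfl

theorem push_le {l l' : List ι → ℝ≥0∞} (h : ∀ w, l w ≤ l' w) (n : ℕ) (w : List ι) :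
    push n l w ≤ push n l' w := wsum_mono fun _ _ => h _

theorem push_add (l l' : List ι → ℝ≥0∞) (n : ℕ) (w : List ι) :
    push n (fun w => l w + l' w) w = push n l w + push n l' w := wsum_add _ _ _

theorem push_const_mul (c : ℝ≥0∞) (l : List ι → ℝ≥0∞) (n : ℕ) (w : List ι) :
    push n (fun w => c * l w) w = c * push n l w := wsum_const_mul _ _ _

/-- The word weights of a mixing shift-invariant probability measure. -/
structure IsMixing (m : List ι → ℝ≥0∞) : Prop where
  nil : m [] = 1
  consistent : IsConsistent m
  invariant : ∀ w, ∑' a, m (a :: w) = m w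
  tendsto : ∀ u w, Tendsto (fun n => push n (fun w => m (u ++ w)) w) atTop (𝓝 (m u * m w))

theorem IsMixing.le_one {m : List ι → ℝ≥0∞} (hm : IsMixing m) (w : List ι) : m w ≤ 1 := by
  simpa [hm.nil] using hm.consistent.append_le [] w

theorem IsMixing.ne_top {m : List ι → ℝ≥0∞} (hm : IsMixing m) (w : List ι) : m w ≠ ∞ :=
  ne_top_of_le_ne_top ENNReal.one_ne_top (hm.le_one w)

theorem IsMixing.push_eq {m : List ι → ℝ≥0∞} (hm : IsMixing m) (n : ℕ) : push n m = m := by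
  induction n with
  | zero => rfl
  | succ n ih => rw [← push_push, ih]; exact funext hm.invariant

/-- At a word where the ratio `ν / m` is almost maximal, it stays almost maximal on extensions. -/
theorem mul_push_le {m ν : List ι → ℝ≥0∞} {R δ : ℝ≥0∞} {u : List ι} (hm : IsMixing m)
    (hν : ∀ n, ν u ≤ wsum n fun v => ν (u ++ v)) (hR : ∀ w, ν w ≤ R * m w) (hR' : R ≠ ∞)
    (hu : R * m u ≤ ν u + δ) (n : ℕ) (w : List ι) :
    R * push n (fun w => m (u ++ w)) w ≤ push n (fun w => ν (u ++ w)) w + δ := by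
  -- The deficit R·m − ν is nonnegative. Over all extensions of u of a given length it totals at
  -- most R·m(u) − ν(u) ≤ δ, as m is consistent and ν gains mass under extension. A single deficit
  -- is no larger than the total.
  have h := add_wsum_le (F := push n (fun w => ν (u ++ w)))
    (G := push n (fun w => R * m (u ++ w))) (w := w) (fun v => push_le (fun _ => hR _) n v)
  have e (l : List ι → ℝ≥0∞) : wsum w.length (push n fun w => l (u ++ w)) =
      wsum (n + w.length) fun v => l (u ++ v) := by
    rw [wsum_append, wsum_comm]; rfl
  have e1 := e ν
  have e2 := e fun v => R * m v
  rw [wsum_const_mul, hm.consistent.wsum] at e2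
  rw [e1, e2, push_const_mul] at h
  set S := wsum (n + w.length) fun v => ν (u ++ v) with hS
  have hS' : S ≠ ∞ := by
    refine ne_top_of_le_ne_top (b := R * m u) (ENNReal.mul_ne_top hR' (hm.ne_top _)) ?_
    rw [← hm.consistent.wsum (n + w.length) u, ← wsum_const_mul]
    exact wsum_mono fun v _ => hR _
  refine (ENNReal.add_le_add_iff_right hS').1 (h.trans ?_)
  calc _ ≤ push n (fun w => ν (u ++ w)) w + (S + δ) := by
        gcongr; exact hu.trans (by gcongr; exact hν _)
    _ = _ := by ring

/-- A mixing weight inherits regularity relative to any comparable regular weight. -/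
theorem IsMixing.relHolder_of_comparable {m ν : List ι → ℝ≥0∞} {ζ K : ℝ} {c : ℝ≥0∞}
    (hm : IsMixing m) (hν : ∀ n u, ν u ≤ wsum n fun v => ν (u ++ v)) (hle : ∀ w, ν w ≤ c * m w)
    (hc : c ≠ ∞) (hpos : ν [] ≠ 0)
    (hrel : ∀ u, RelHolder ζ K (fun w => ν (u ++ w)) ν) : RelHolder ζ K m ν := by
  set R : ℝ≥0∞ := ⨆ u, ν u / m u with hRdef
  have hRle (w : List ι) : ν w ≤ R * m w := by
    by_cases h0 : m w = 0
    · simpa [h0] using hle w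
    · exact (ENNReal.div_le_iff h0 (hm.ne_top w)).1 (le_iSup (fun u => ν u / m u) w)
  have hRc : R ≤ c := iSup_le fun u => ENNReal.div_le_of_le_mul (hle u)
  have hRtop : R ≠ ∞ := ne_top_of_le_ne_top hc hRc
  have hR0 : R ≠ 0 := by
    intro h
    have := hRle []
    simp [h, hpos] at this
  have hνtop (w : List ι) : ν w ≠ ∞ :=
    ne_top_of_le_ne_top (ENNReal.mul_ne_top hc (hm.ne_top w)) (hle w)
  intro w z z' hw
  set d := distortionFactor ζ K w.length
  have hd : d ≠ ∞ := distortionFactor_ne_top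
  refine (ENNReal.mul_le_mul_iff_right hR0 hRtop).1 ?_
  refine ENNReal.le_of_forall_pos_le_add fun ε hε _ => ?_
  -- δ is fixed before u, small enough for the final error δ·ν(w z') to be below ε.
  obtain ⟨δ, hδ0, hδ⟩ : ∃ δ : ℝ≥0∞, δ ≠ 0 ∧ δ * ν (w ++ z') ≤ ε := by
    by_cases h0 : ν (w ++ z') = 0
    · exact ⟨1, one_ne_zero, by simp [h0]⟩
    · exact ⟨ε / ν (w ++ z'), by simp [hε.ne', hνtop],
        by rw [ENNReal.div_mul_cancel h0 (hνtop _)]⟩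
  obtain ⟨u, hu⟩ : ∃ u, R - δ < ν u / m u :=
    lt_iSup_iff.1 (ENNReal.sub_lt_self hRtop hR0 hδ0)
  have hu0 : m u ≠ 0 := by
    intro h
    have : ν u = 0 := by simpa [h] using hle u
    simp [this] at hu
  -- The defect is proportional to m(u), so dividing by m(u) after the limit leaves an error
  -- independent of u.
  have hu' : R * m u ≤ ν u + δ * m u := by
    calc R * m u ≤ (ν u / m u + δ) * m u := by
          gcongr; exact tsub_le_iff_right.1 hu.le
      _ = _ := by rw [add_mul, ENNReal.div_mul_cancel hu0 (hm.ne_top u)]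
  -- Below u, replace R·m by ν at the cost of the defect, exchange z and z' by the regularity of ν,
  -- and return to R·m by maximality of R. As n → ∞, mixing turns both pushed weights into m(u)
  -- m(·).
  have key (n : ℕ) : R * push n (fun w => m (u ++ w)) (w ++ z) * ν (w ++ z') ≤
      d * (R * push n (fun w => m (u ++ w)) (w ++ z') * ν (w ++ z)) + δ * m u * ν (w ++ z') := by
    calc _ ≤ (push n (fun w => ν (u ++ w)) (w ++ z) + δ * m u) * ν (w ++ z') := by
          gcongr; exact mul_push_le hm (fun n => hν n u) hRle hRtop hu' n _
      _ = push n (fun w => ν (u ++ w)) (w ++ z) * ν (w ++ z') + δ * m u * ν (w ++ z') := add_mul _ _ _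
      _ ≤ _ := by
        refine add_le_add ?_ le_rfl
        calc _ ≤ d * (push n (fun w => ν (u ++ w)) (w ++ z') * ν (w ++ z)) := by
              simp only [push]
              rw [← wsum_mul_const, ← wsum_mul_const, ← wsum_const_mul]
              refine wsum_mono fun v _ => ?_
              simpa using hrel (u ++ v) w z z' hw
          _ ≤ _ := by
            refine mul_le_mul' le_rfl (mul_le_mul' ?_ le_rfl)
            rw [← push_const_mul]
            exact push_le (fun _ => hRle _) _ _
  have lim1 := ENNReal.Tendsto.mul_const (b := ν (w ++ z')) (ENNReal.Tendsto.const_mul (a := R) (hm.tendsto u (w ++ z))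
    (Or.inr hRtop)) (Or.inr (hνtop (w ++ z')))
  have lim2 := (ENNReal.Tendsto.const_mul (a := d) (ENNReal.Tendsto.mul_const (b := ν (w ++ z)) (ENNReal.Tendsto.const_mul (a := R)
    (hm.tendsto u (w ++ z')) (Or.inr hRtop)) (Or.inr (hνtop (w ++ z)))) (Or.inr hd)).add_const (δ * m u * ν (w ++ z'))
  have h := le_of_tendsto_of_tendsto' lim1 lim2 key
  refine (ENNReal.mul_le_mul_iff_right hu0 (hm.ne_top u)).1 ?_
  calc m u * (R * (m (w ++ z) * ν (w ++ z'))) = R * (m u * m (w ++ z)) * ν (w ++ z') := by ring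
    _ ≤ _ := h
    _ = m u * (R * (d * (m (w ++ z') * ν (w ++ z))) + δ * ν (w ++ z')) := by ring
    _ ≤ _ := by gcongr

/-- A mixing weight comparable to a weight with locally Hölder ratios has locally Hölder ratios. -/
theorem IsMixing.relHolder {m q : List ι → ℝ≥0∞} {ζ K : ℝ} {c : ℝ≥0∞} (hζ : 0 ≤ ζ) (hζ' : ζ ≤ 1)
    (hK : 0 ≤ K) (hm : IsMixing m)
    (hc : c ≠ ∞) (hmq : ∀ w, m w ≤ c * q w) (hqm : ∀ w, q w ≤ c * m w)
    (hq : ∀ u, RelHolder ζ K (fun w => q (u ++ w)) q) (u : List ι) :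
    RelHolder ζ (3 * K) (fun w => m (u ++ w)) m := by
  set ν := extensionLimsup q with hν
  have hνm : ∀ w, ν w ≤ c * m w := extensionLimsup_le hm.consistent hqm
  have hmν : ∀ w, m w ≤ c * ν w := le_extensionLimsup hm.consistent hmq hc
  have hνtop (w : List ι) : ν w ≠ ∞ :=
    ne_top_of_le_ne_top (ENNReal.mul_ne_top hc (hm.ne_top w)) (hνm w)
  have hqtop (w : List ι) (n : ℕ) : (wsum n fun v => q (w ++ v)) ≠ ∞ := by
    refine ne_top_of_le_ne_top (b := c * m w) (ENNReal.mul_ne_top hc (hm.ne_top w)) ?_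
    rw [← hm.consistent.wsum n w, ← wsum_const_mul]
    exact wsum_mono fun v _ => hqm _
  have hshift (u : List ι) : extensionLimsup (fun w => q (u ++ w)) = fun w => ν (u ++ w) := by
    funext w; simp [hν, extensionLimsup]
  have hrel (u : List ι) : RelHolder ζ K (fun w => ν (u ++ w)) ν := by
    have := (hq u).extensionLimsup (fun w n => by simpa using hqtop (u ++ w) n) hqtop
      (fun w => by rw [hshift]; exact hνtop _) hνtop
    rwa [hshift] at this
  have hmrel : RelHolder ζ K m ν := hm.relHolder_of_comparable
    (fun n w => extensionLimsup_le_wsum hm.consistent hqm hc hm.ne_top n w) hνm hc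
    (fun h => by simpa [h, hm.nil] using hmν []) hrel
  intro w z z' hw
  have hzero {w : List ι} (h : ν w = 0) : m w = 0 := by simpa [h] using hmν w
  set d := distortionFactor ζ K w.length with hd
  -- Factor m(u·)/m as m(u·)/ν(u·) times ν(u·)/ν times ν/m. Each ratio costs one factor d; for the
  -- first one the common word is u w, longer than w, which only helps.
  have h1 : m (u ++ (w ++ z)) * ν (u ++ (w ++ z')) ≤
      d * (m (u ++ (w ++ z')) * ν (u ++ (w ++ z))) := by
    have := hmrel (u ++ w) z z' (by simp [hw])
    simp only [List.append_assoc] at this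
    refine this.trans ?_
    gcongr
    refine distortionFactor_mono (mul_le_mul_of_nonneg_left ?_ hK)
    exact pow_le_pow_of_le_one hζ hζ' (by simp)
  have h2 := hmrel w z' z hw
  have h3 := hrel u w z z' hw
  simp only at h3 ⊢
  have hd3 : distortionFactor ζ (3 * K) w.length = d * d * d := by
    rw [hd, distortionFactor_mul, distortionFactor_mul]; ring_nf
  rw [hd3]
  by_cases a1 : ν (u ++ (w ++ z)) = 0
  · simp [hzero a1]
  by_cases a2 : ν (w ++ z') = 0
  · simp [hzero a2]
  have h0 : d * (ν (u ++ (w ++ z')) * ν (w ++ z)) ≠ 0 :=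
    fun h => by rw [h] at h3; simp [a1, a2] at h3
  have a3 : ν (u ++ (w ++ z')) ≠ 0 := fun h => by simp [h] at h0
  have a4 : ν (w ++ z) ≠ 0 := fun h => by simp [h] at h0
  have hA0 : ν (u ++ (w ++ z')) * ν (w ++ z) * (ν (u ++ (w ++ z)) * ν (w ++ z')) ≠ 0 := by
    simp [a1, a2, a3, a4]
  have hAt : ν (u ++ (w ++ z')) * ν (w ++ z) * (ν (u ++ (w ++ z)) * ν (w ++ z')) ≠ ∞ := by
    simp [ENNReal.mul_eq_top, hνtop]
  refine (ENNReal.mul_le_mul_iff_right hA0 hAt).1 ?_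
  calc _ = (m (u ++ (w ++ z)) * ν (u ++ (w ++ z'))) * (m (w ++ z') * ν (w ++ z)) *
        (ν (u ++ (w ++ z)) * ν (w ++ z')) := by ring
    _ ≤ _ := mul_le_mul' (mul_le_mul' h1 h2) h3
    _ = _ := by ring

/-! ### Uniform minorization -/

/-- If extensions are quasi-independent, finitely many symbols carry half of every extension. -/
theorem IsMixing.exists_finset {m : List ι → ℝ≥0∞} (hm : IsMixing m) {C : ℝ≥0∞} (hC : C ≠ ∞) :
    ∃ F : Finset ι, ∀ (f : ι → ℝ≥0∞) (M : ℝ≥0∞), M ≠ ∞ → ∑' a, f a = M →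
      (∀ a, f a ≤ C * M * m [a]) → M ≤ 2 * ∑ a ∈ F, f a := by
  have hsum : ∑' a, m [a] = 1 := by simpa [hm.nil] using hm.consistent []
  have htail := ENNReal.tendsto_tsum_compl_atTop_zero (f := fun a => m [a]) (by simp [hsum])
  have htail' := ENNReal.Tendsto.const_mul (a := C) htail (Or.inr hC)
  rw [mul_zero] at htail'
  -- Outside F the total mass of m is below 1/(2C), so any f dominated by C·M·m has at most M/2
  -- there.
  obtain ⟨F, hF⟩ := (htail'.eventually_lt_const (u := 2⁻¹) (by simp)).exists
  refine ⟨F, fun f M hM hf hfa => ?_⟩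
  have h1 : ∑ a ∈ F, f a + ∑' a : {a // a ∉ F}, f a = M := by
    rw [← hf, ← ENNReal.sum_add_tsum_compl F f]; rfl
  have h2 : ∑' a : {a // a ∉ F}, f a ≤ M * 2⁻¹ := by
    calc _ ≤ ∑' a : {a // a ∉ F}, C * M * m [a.1] := ENNReal.tsum_le_tsum fun a => hfa a
      _ = M * (C * ∑' a : {a // a ∉ F}, m [a.1]) := by rw [ENNReal.tsum_mul_left]; ring
      _ ≤ _ := by gcongr
  have h3 : M * 2⁻¹ + M * 2⁻¹ = M := by rw [← mul_add, ENNReal.inv_two_add_inv_two, mul_one]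
  have h4 : M * 2⁻¹ ≤ ∑ a ∈ F, f a := by
    refine (ENNReal.add_le_add_iff_right (a := M * 2⁻¹)
      (ENNReal.mul_ne_top hM (by simp))).1 ?_
    calc _ = M := h3
      _ = _ := h1.symm
      _ ≤ _ := by gcongr
  calc M = M * 2⁻¹ + M * 2⁻¹ := h3.symm
    _ ≤ _ := by rw [two_mul]; gcongr

/-- Regularity at the one-letter word s glues u s to s v t, and regularity at t glues u s v t to t
w; each gluing costs one distortion factor. Summing over v joins u to w through words s v t. -/
theorem IsMixing.push_connect {m : List ι → ℝ≥0∞} {ζ K : ℝ}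
    (hJ : ∀ u, RelHolder ζ K (fun w => m (u ++ w)) m) (u w : List ι) (s t : ι) (n : ℕ) :
    m (u ++ [s]) * push n (fun w => m ([s] ++ w)) [t] * m ([t] ++ w) ≤
      distortionFactor ζ K 1 ^ 2 * (m [s] * m [t]) *
        wsum n fun v => m (u ++ [s] ++ v ++ [t] ++ w) := by
  rw [push, ← wsum_const_mul, ← wsum_mul_const, ← wsum_const_mul]
  refine wsum_mono fun v _ => ?_
  have h1 := hJ u [s] [] (v ++ [t]) (by simp)
  have h2 := hJ (u ++ [s] ++ v) [t] [] w (by simp)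
  simp only [List.append_assoc, List.append_nil, List.length_singleton] at h1 h2 ⊢
  calc _ ≤ distortionFactor ζ K 1 * (m (u ++ ([s] ++ (v ++ [t]))) * m [s]) * m ([t] ++ w) := by
        gcongr
    _ = distortionFactor ζ K 1 * m [s] * (m (u ++ ([s] ++ (v ++ [t]))) * m ([t] ++ w)) := by ring
    _ ≤ distortionFactor ζ K 1 * m [s] *
          (distortionFactor ζ K 1 * (m (u ++ ([s] ++ (v ++ ([t] ++ w)))) * m [t])) := by gcongr
    _ = _ := by ring

/-- After sufficiently many steps the system forgets at least a fixed proportion of its past. -/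
theorem IsMixing.exists_le_push {m : List ι → ℝ≥0∞} (hm : IsMixing m) {ζ K : ℝ} {C : ℝ≥0∞}
    (hC : C ≠ ∞) (hqb : ∀ u w, m (u ++ w) ≤ C * (m u * m w))
    (hJ : ∀ u, RelHolder ζ K (fun w => m (u ++ w)) m) :
    ∃ ε : ℝ≥0∞, ε ≠ 0 ∧ ∃ N : ℕ, ∀ n ≥ N, ∀ u w,
      ε * (m u * m w) ≤ push n (fun w => m (u ++ w)) w := by
  obtain ⟨F, hF⟩ := hm.exists_finset hC
  set d := distortionFactor ζ K 1 with hd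
  -- Mixing is used for finitely many pairs only, so one n serves them all.
  obtain ⟨n, hn⟩ : ∃ n, ∀ s ∈ F, ∀ t ∈ F,
      m [s] * m [t] ≤ 2 * push n (fun w => m ([s] ++ w)) [t] := by
    refine (((F.eventually_all).2 fun s _ => (F.eventually_all).2 fun t _ => ?_) :
      ∀ᶠ n in atTop, _).exists
    by_cases h0 : m [s] * m [t] = 0
    · simp [h0]
    have ht := ENNReal.Tendsto.const_mul (a := 2) (hm.tendsto [s] [t]) (Or.inr (by simp))
    refine (ht.eventually_const_lt ?_).mono fun n h => h.le
    rw [two_mul]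
    exact ENNReal.lt_add_right (ENNReal.mul_ne_top (hm.ne_top _) (hm.ne_top _)) h0
  -- Restricting both end letters to F costs 2 · 2, mixing costs 2 and the two gluings cost d². The
  -- joining word s v t has n + 2 letters.
  have main (u w : List ι) : m u * m w ≤ 8 * d ^ 2 * push (n + 2) (fun w => m (u ++ w)) w := by
    have hst (s t : ι) (hs : s ∈ F) (ht : t ∈ F) : m (u ++ [s]) * m ([t] ++ w) ≤
        2 * d ^ 2 * wsum n fun v => m (u ++ [s] ++ v ++ [t] ++ w) := by
      by_cases h0 : m [s] * m [t] = 0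
      · have : m (u ++ [s]) * m ([t] ++ w) ≤ 0 := by
          calc _ ≤ C * (m u * m [s]) * (C * (m [t] * m w)) := mul_le_mul' (hqb _ _) (hqb _ _)
            _ = C * m u * C * m w * (m [s] * m [t]) := by ring
            _ = 0 := by rw [h0, mul_zero]
        exact this.trans zero_le
      · have h1 := hm.ne_top [s]
        have h2 := hm.ne_top [t]
        refine (ENNReal.mul_le_mul_iff_right h0 (ENNReal.mul_ne_top h1 h2)).1 ?_
        calc m [s] * m [t] * (m (u ++ [s]) * m ([t] ++ w)) ≤
              2 * push n (fun w => m ([s] ++ w)) [t] * (m (u ++ [s]) * m ([t] ++ w)) := by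
              exact mul_le_mul' (hn s hs t ht) le_rfl
          _ = 2 * (m (u ++ [s]) * push n (fun w => m ([s] ++ w)) [t] * m ([t] ++ w)) := by ring
          _ ≤ 2 * (d ^ 2 * (m [s] * m [t]) * wsum n fun v => m (u ++ [s] ++ v ++ [t] ++ w)) :=
              mul_le_mul' le_rfl (IsMixing.push_connect hJ u w s t n)
          _ = _ := by ring
    have hu : m u ≤ 2 * ∑ s ∈ F, m (u ++ [s]) := hF _ _ (hm.ne_top u) (hm.consistent u)
      fun a => by simpa only [mul_assoc] using hqb u [a]
    have hw : m w ≤ 2 * ∑ t ∈ F, m ([t] ++ w) := hF _ _ (hm.ne_top w) (hm.invariant w)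
      fun a => by
        have := hqb [a] w
        rw [List.singleton_append] at this
        exact this.trans_eq (by ring)
    calc m u * m w ≤ (2 * ∑ s ∈ F, m (u ++ [s])) * (2 * ∑ t ∈ F, m ([t] ++ w)) :=
          mul_le_mul' hu hw
      _ = 4 * ∑ s ∈ F, ∑ t ∈ F, m (u ++ [s]) * m ([t] ++ w) := by
          rw [← Finset.sum_mul_sum]; ring
      _ ≤ 4 * ∑ s ∈ F, ∑ t ∈ F, 2 * d ^ 2 * wsum n fun v => m (u ++ [s] ++ v ++ [t] ++ w) := by
          exact mul_le_mul' le_rfl (Finset.sum_le_sum fun s hs => Finset.sum_le_sum fun t ht =>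
            hst s t hs ht)
      _ = 8 * d ^ 2 * ∑ s ∈ F, ∑ t ∈ F, wsum n fun v => m (u ++ [s] ++ v ++ [t] ++ w) := by
          simp_rw [← Finset.mul_sum]; ring
      _ ≤ 8 * d ^ 2 * push (n + 2) (fun w => m (u ++ w)) w := by
          gcongr
          calc _ ≤ ∑ s ∈ F, ∑' t, wsum n fun v => m (u ++ [s] ++ v ++ [t] ++ w) :=
                Finset.sum_le_sum fun s _ => ENNReal.sum_le_tsum F
            _ ≤ ∑' s, ∑' t, wsum n fun v => m (u ++ [s] ++ v ++ [t] ++ w) := ENNReal.sum_le_tsum F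
            _ = _ := by
              rw [push, show n + 2 = (n + 1) + 1 from rfl, wsum]
              refine tsum_congr fun s => ?_
              rw [wsum_succ_right]
              simp
  have hd0 : 8 * d ^ 2 ≠ 0 := by simp [hd, distortionFactor_ne_zero]
  have hdt : 8 * d ^ 2 ≠ ∞ := ENNReal.mul_ne_top (by simp) (ENNReal.pow_ne_top distortionFactor_ne_top)
  -- Since m is invariant under `push`, the bound persists for all later times.
  refine ⟨(8 * d ^ 2)⁻¹, ENNReal.inv_ne_zero.2 hdt, n + 2, fun k hk u w => ?_⟩
  obtain ⟨i, rfl⟩ := Nat.exists_eq_add_of_le hk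
  rw [← push_push, mul_comm, ← div_eq_mul_inv]
  calc m u * m w / (8 * d ^ 2) = push i (fun w => m u / (8 * d ^ 2) * m w) w := by
        rw [push_const_mul, hm.push_eq, ENNReal.mul_div_right_comm]
    _ ≤ _ := push_le (fun w => ?_) _ _
  rw [← ENNReal.mul_div_right_comm]
  exact ENNReal.div_le_of_le_mul' (main u w)

/-! ### Weights with Hölder density and the transfer operator -/

/-- Weights absolutely continuous with respect to `m`, with locally Hölder density. -/
structure IsRegular (ζ K : ℝ) (m l : List ι → ℝ≥0∞) : Prop where
  consistent : IsConsistent l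
  null : ∀ w, m w = 0 → l w = 0
  ne_top : l [] ≠ ∞
  rel : RelHolder ζ K l m

theorem IsRegular.apply_ne_top {ζ K : ℝ} {m l : List ι → ℝ≥0∞} (hl : IsRegular ζ K m l)
    (w : List ι) : l w ≠ ∞ :=
  ne_top_of_le_ne_top hl.ne_top (by simpa using hl.consistent.append_le [] w)

theorem IsRegular.push_nil {ζ K : ℝ} {m l : List ι → ℝ≥0∞} (hl : IsRegular ζ K m l) (n : ℕ) :
    push n l [] = l [] := by
  simpa [push] using hl.consistent.wsum n []

/-- A Lasota–Yorke inequality. Prefixing a letter lengthens the common word, which multiplies the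
constant of the density by ζ, and the ratio m(a·)/m adds K'. As K' ≤ K(1 − ζ), the level K is stable
and the excess s contracts by ζ. -/
theorem IsRegular.push_one {m l : List ι → ℝ≥0∞} (hm : IsMixing m) {ζ K K' s : ℝ} (hζ : 0 ≤ ζ)
    (hJ : ∀ u, RelHolder ζ K' (fun w => m (u ++ w)) m) (hK : K' ≤ K * (1 - ζ))
    (hl : IsRegular ζ (K + s) m l) : IsRegular ζ (K + s * ζ) m (push 1 l) where
  consistent w := by
    simp only [WordWeight.push_one]
    rw [ENNReal.tsum_comm]
    exact tsum_congr fun a => hl.consistent (a :: w)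
  null w hw := by
    rw [WordWeight.push_one, ENNReal.tsum_eq_zero]
    intro a
    refine hl.null _ (le_antisymm ?_ zero_le)
    rw [← hw, ← hm.invariant w]
    exact ENNReal.le_tsum (f := fun a => m (a :: w)) a
  ne_top := by rw [hl.push_nil]; exact hl.ne_top
  rel w z z' hw := by
    rw [WordWeight.push_one, WordWeight.push_one, ← ENNReal.tsum_mul_right, ← ENNReal.tsum_mul_right,
      ← ENNReal.tsum_mul_left]
    refine ENNReal.tsum_le_tsum fun a => ?_
    have h1 := hl.rel (a :: w) z z' (by simp)
    have h2 := hJ [a] w z z' hw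
    simp only [List.cons_append, List.nil_append, List.length_cons] at h1 h2
    by_cases a1 : m (a :: (w ++ z)) = 0
    · simp [hl.null _ a1]
    by_cases a2 : m (a :: (w ++ z')) = 0
    · have : m (w ++ z') = 0 := by simpa [a2, a1] using h2
      simp [this]
    refine (ENNReal.mul_le_mul_iff_right (a := m (a :: (w ++ z)) * m (a :: (w ++ z')))
      (by simp [a1, a2]) (ENNReal.mul_ne_top (hm.ne_top _) (hm.ne_top _))).1 ?_
    calc _ = (l (a :: (w ++ z)) * m (a :: (w ++ z'))) * (m (a :: (w ++ z)) * m (w ++ z')) := by ring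
      _ ≤ _ := mul_le_mul' h1 h2
      _ = (distortionFactor ζ (K + s) (w.length + 1) * distortionFactor ζ K' w.length) *
          (m (a :: (w ++ z)) * m (a :: (w ++ z')) * (l (a :: (w ++ z')) * m (w ++ z))) := by ring
      _ ≤ distortionFactor ζ (K + s * ζ) w.length *
          (m (a :: (w ++ z)) * m (a :: (w ++ z')) * (l (a :: (w ++ z')) * m (w ++ z))) := by
        refine mul_le_mul' ?_ le_rfl
        have : distortionFactor ζ (K + s) (w.length + 1) = distortionFactor ζ ((K + s) * ζ) w.length := by
          simp only [distortionFactor]; ring_nf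
        rw [this, distortionFactor_mul]
        refine distortionFactor_mono (mul_le_mul_of_nonneg_right ?_ (pow_nonneg hζ _))
        linarith
      _ = _ := by ring

theorem IsRegular.push {m l : List ι → ℝ≥0∞} (hm : IsMixing m) {ζ K K' s : ℝ} (hζ : 0 ≤ ζ)
    (hJ : ∀ u, RelHolder ζ K' (fun w => m (u ++ w)) m) (hK : K' ≤ K * (1 - ζ))
    (hl : IsRegular ζ (K + s) m l) (n : ℕ) :
    IsRegular ζ (K + s * ζ ^ n) m (WordWeight.push n l) := by
  induction n with
  | zero => simpa [push_zero] using hl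
  | succ n ih =>
    rw [← push_push, pow_succ, ← mul_assoc]
    exact ih.push_one hm hζ hJ hK

/-- Up to distortion the density of l on the cylinder of a letter a is l[a]/m[a], and
quasi-independence bounds m(a w) by C m[a] m(w). Summing over a loses no mass. -/
theorem IsRegular.push_one_le {m l : List ι → ℝ≥0∞} (hm : IsMixing m) {ζ K : ℝ} {C : ℝ≥0∞}
    (hqb : ∀ u w, m (u ++ w) ≤ C * (m u * m w)) (hl : IsRegular ζ K m l) (w : List ι) :
    WordWeight.push 1 l w ≤ distortionFactor ζ K 1 * C * (l [] * m w) := by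
  have hsum : ∑' a, l [a] = l [] := hl.consistent []
  rw [WordWeight.push_one, ← hsum, ← ENNReal.tsum_mul_right, ← ENNReal.tsum_mul_left]
  refine ENNReal.tsum_le_tsum fun a => ?_
  by_cases h0 : m [a] = 0
  · have : m (a :: w) = 0 := by simpa [h0] using hqb [a] w
    simp [hl.null _ this]
  refine (ENNReal.mul_le_mul_iff_right h0 (hm.ne_top _)).1 ?_
  have h1 := hl.rel [a] w [] (by simp)
  have h2 := hqb [a] w
  simp only [List.cons_append, List.nil_append, List.length_singleton] at h1 h2
  calc m [a] * l (a :: w) = l (a :: w) * m [a] := mul_comm _ _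
    _ ≤ _ := h1
    _ ≤ distortionFactor ζ K 1 * (l [a] * (C * (m [a] * m w))) := by gcongr
    _ = _ := by ring

/-- The first letter fixes the density up to distortion, and the remaining n steps use the
minorization for m; hence n + 1. -/
theorem IsRegular.le_push {m l : List ι → ℝ≥0∞} (hm : IsMixing m) {ζ K : ℝ} {ε : ℝ≥0∞} {n : ℕ}
    (hε : ∀ u w, ε * (m u * m w) ≤ WordWeight.push n (fun w => m (u ++ w)) w)
    (hl : IsRegular ζ K m l) (w : List ι) :
    ε * (l [] * m w) ≤ distortionFactor ζ K 1 * WordWeight.push (n + 1) l w := by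
  have hsum : ∑' a, l [a] = l [] := hl.consistent []
  rw [push_succ, ← hsum, ← ENNReal.tsum_mul_right, ← ENNReal.tsum_mul_left, ← ENNReal.tsum_mul_left]
  refine ENNReal.tsum_le_tsum fun a => ?_
  by_cases h0 : m [a] = 0
  · simp [hl.null _ h0]
  refine (ENNReal.mul_le_mul_iff_right h0 (hm.ne_top _)).1 ?_
  calc m [a] * (ε * (l [a] * m w)) = l [a] * (ε * (m [a] * m w)) := by ring
    _ ≤ l [a] * WordWeight.push n (fun w => m ([a] ++ w)) w := by gcongr; exact hε _ _
    _ ≤ distortionFactor ζ K 1 * (WordWeight.push n (fun v => l (a :: v)) w * m [a]) := by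
      simp only [WordWeight.push]
      rw [← wsum_const_mul, ← wsum_mul_const, ← wsum_const_mul]
      refine wsum_mono fun v _ => ?_
      simpa using hl.rel [a] [] (v ++ w) (by simp)
    _ = _ := by ring

/-- For densities X = x/A and Y = y/B with X ≤ dY, removing a constant e ≤ Y/2 gives X − e ≤ d²(Y −
e), because e(d + 1) ≤ dY when d ≥ 1. -/
theorem sub_mul_le_aux {x y A B d e : ℝ≥0∞} (hx : x ≠ ∞) (hA : A ≠ ∞) (hB : B ≠ ∞) (hd : d ≠ ∞)
    (he : e ≠ ∞) (hd1 : 1 ≤ d) (hxA : e * A ≤ x) (hyB : 2 * (e * B) ≤ y) (h : x * B ≤ d * (y * A)) :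
    (x - e * A) * B ≤ d * d * ((y - e * B) * A) := by
  obtain ⟨x', rfl⟩ := exists_add_of_le hxA
  have hyB' : e * B ≤ y := le_trans (by rw [two_mul]; exact le_self_add) hyB
  obtain ⟨y', rfl⟩ := exists_add_of_le hyB'
  obtain ⟨t, rfl⟩ := exists_add_of_le hd1
  have heA : e * A ≠ ∞ := ENNReal.mul_ne_top he hA
  have heB : e * B ≠ ∞ := ENNReal.mul_ne_top he hB
  rw [ENNReal.add_sub_cancel_left heA, ENNReal.add_sub_cancel_left heB]
  rw [two_mul] at hyB
  have hy' : e * B ≤ y' := (ENNReal.add_le_add_iff_left heB).1 hyB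
  have h1 : e * A * B + x' * B ≤ e * A * B + (t * (e * B) * A + (1 + t) * (y' * A)) := by
    calc _ = (e * A + x') * B := by ring
      _ ≤ _ := h
      _ = _ := by ring
  have h2 := (ENNReal.add_le_add_iff_left (ENNReal.mul_ne_top heA hB)).1 h1
  calc x' * B ≤ _ := h2
    _ ≤ t * y' * A + (1 + t) * (y' * A) := by gcongr
    _ ≤ t * y' * A + (1 + t) * (y' * A) + t * t * (y' * A) := le_self_add
    _ = _ := by ring

/-- Removing at most half of the density doubles the logarithmic constant at worst. -/
theorem IsRegular.sub {m l : List ι → ℝ≥0∞} (hm : IsMixing m) {ζ K : ℝ} {e : ℝ≥0∞} (hζ : 0 ≤ ζ)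
    (hK : 0 ≤ K) (he : e ≠ ∞)
    (hl : IsRegular ζ K m l) (hle : ∀ w, 2 * (e * m w) ≤ l w) :
    IsRegular ζ (2 * K) m fun w => l w - e * m w := by
  have hle' (w : List ι) : e * m w ≤ l w := le_trans (by rw [two_mul]; exact le_self_add) (hle w)
  refine ⟨fun w => ?_, fun w hw => by simp [hl.null w hw], ENNReal.sub_ne_top hl.ne_top,
    fun w z z' hw => ?_⟩
  · refine (ENNReal.add_left_inj (a := e * m w) (ENNReal.mul_ne_top he (hm.ne_top w))).1 ?_
    rw [tsub_add_cancel_of_le (hle' w)]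
    rw [← hm.consistent w, ← ENNReal.tsum_mul_left, ← ENNReal.tsum_add, ← hl.consistent w]
    exact tsum_congr fun a => tsub_add_cancel_of_le (hle' _)
  · have hd : distortionFactor ζ (2 * K) w.length =
        distortionFactor ζ K w.length * distortionFactor ζ K w.length := by
      rw [distortionFactor_mul]; ring_nf
    rw [hd]
    refine sub_mul_le_aux (hl.apply_ne_top _) (hm.ne_top _) (hm.ne_top _) distortionFactor_ne_top he
      ?_ (hle' _) (hle _) (hl.rel w z z' hw)
    rw [distortionFactor, ENNReal.one_le_ofReal]
    exact Real.one_le_exp (by positivity)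

/-! ### Geometric convergence and ψ-mixing -/

theorem distortionFactor_antitone_left {ζ K L : ℝ} (hζ : 0 ≤ ζ) (h : K ≤ L) (k : ℕ) :
    distortionFactor ζ K k ≤ distortionFactor ζ L k :=
  distortionFactor_mono (mul_le_mul_of_nonneg_right h (pow_nonneg hζ _))

theorem IsRegular.mono {m l : List ι → ℝ≥0∞} {ζ K L : ℝ} (hζ : 0 ≤ ζ) (h : K ≤ L)
    (hl : IsRegular ζ K m l) : IsRegular ζ L m l :=
  ⟨hl.consistent, hl.null, hl.ne_top, fun w z z' hw => (hl.rel w z z' hw).trans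
    (mul_le_mul' (distortionFactor_antitone_left hζ h _) le_rfl)⟩

/-- Geometric convergence from above, along multiples of a fixed number of steps. -/
theorem IsRegular.push_mul_add_one_le {m : List ι → ℝ≥0∞} (hm : IsMixing m) {ζ K : ℝ}
    {A e r : ℝ≥0∞} {N : ℕ} (hr : e + r = 1)
    (hA : ∀ l, IsRegular ζ K m l → ∀ w, WordWeight.push 1 l w ≤ A * (l [] * m w))
    (hdec : ∀ l, IsRegular ζ K m l → (∀ w, e * l [] * m w ≤ WordWeight.push N l w) ∧
      IsRegular ζ K m fun w => WordWeight.push N l w - e * l [] * m w)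
    (j : ℕ) (l : List ι → ℝ≥0∞) (hl : IsRegular ζ K m l) (w : List ι) :
    WordWeight.push (N * j + 1) l w ≤ (1 + A * r ^ j) * (l [] * m w) := by
  have he : e ≠ ∞ := ne_top_of_le_ne_top ENNReal.one_ne_top (hr ▸ le_self_add)
  induction j generalizing l w with
  | zero =>
    refine (hA l hl w).trans ?_
    simp only [pow_zero, mul_one]
    gcongr
    exact le_add_self
  | succ j ih =>
    -- After N steps l splits into e·l[]·m, which no longer moves, and a remainder l' in the same
    -- class with mass r·l[]. Only the remainder still carries the crude constant A.
    obtain ⟨h1, h2⟩ := hdec l hl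
    set l' := fun w => WordWeight.push N l w - e * l [] * m w with hl'
    have hsplit : WordWeight.push N l = fun w => e * l [] * m w + l' w :=
      funext fun w => (add_tsub_cancel_of_le (h1 w)).symm
    have hnil : l' [] = r * l [] := by
      refine (ENNReal.add_right_inj (a := e * l []) (ENNReal.mul_ne_top he hl.ne_top)).1 ?_
      have := congrFun hsplit []
      rw [hl.push_nil, hm.nil, mul_one] at this
      rw [← this, ← add_mul, hr, one_mul]
    calc WordWeight.push (N * (j + 1) + 1) l w
        = WordWeight.push (N * j + 1) (WordWeight.push N l) w := by
          rw [push_push]; ring_nf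
      _ = e * l [] * m w + WordWeight.push (N * j + 1) l' w := by
          rw [hsplit, push_add, push_const_mul, hm.push_eq]
      _ ≤ e * l [] * m w + (1 + A * r ^ j) * (r * l [] * m w) := by
          rw [← hnil]; gcongr; exact ih l' h2 w
      _ = (e + r) * (l [] * m w) + A * r ^ (j + 1) * (l [] * m w) := by ring
      _ = _ := by rw [hr]; ring

/-- ρ is the N-th root of r; the factor r⁻¹ pays for rounding k/N down. -/
theorem exists_pow_div_le {r : ℝ} (hr : 0 < r) (hr' : r < 1) {N : ℕ} (hN : N ≠ 0) :
    ∃ ρ : ℝ, 0 < ρ ∧ ρ < 1 ∧ ∀ k : ℕ, r ^ (k / N) ≤ r⁻¹ * ρ ^ k := by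
  refine ⟨r ^ (N⁻¹ : ℝ), Real.rpow_pos_of_pos hr _, Real.rpow_lt_one hr.le hr' (by positivity),
    fun k => ?_⟩
  set ρ := r ^ (N⁻¹ : ℝ) with hρ
  have hρ0 : 0 < ρ := Real.rpow_pos_of_pos hr _
  have hρ1 : ρ ≤ 1 := Real.rpow_le_one hr.le hr'.le (by positivity)
  have hρN : ρ ^ N = r := Real.rpow_inv_natCast_pow hr.le hN
  have hk : k ≤ N * (k / N + 1) := (Nat.lt_mul_div_succ k (Nat.pos_of_ne_zero hN)).le
  have h := pow_le_pow_of_le_one hρ0.le hρ1 hk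
  rw [pow_mul, hρN, pow_succ] at h
  rw [inv_mul_eq_div, le_div_iff₀ hr]
  exact h

/-- Exponential `ψ`-mixing, from above. -/
theorem IsMixing.exists_push_le {m : List ι → ℝ≥0∞} (hm : IsMixing m) {ζ K : ℝ} {C : ℝ≥0∞}
    (hζ : 0 ≤ ζ) (hζ' : ζ < 1) (hK : 0 ≤ K) (hC : C ≠ ∞)
    (hqb : ∀ u w, m (u ++ w) ≤ C * (m u * m w))
    (hJ : ∀ u, RelHolder ζ K (fun w => m (u ++ w)) m) :
    ∃ B ρ : ℝ, 0 < B ∧ 0 < ρ ∧ ρ < 1 ∧ ∀ u n w,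
      push n (fun w => m (u ++ w)) w ≤ ENNReal.ofReal (1 + B * ρ ^ n) * (m u * m w) := by
  obtain ⟨ε, hε0, N₀, hε⟩ := hm.exists_le_push hC hqb hJ
  -- L is the fixed point of the recursion K ↦ ζK + K' of `IsRegular.push_one`, with K' the
  -- regularity constant of m.
  set L := K / (1 - ζ) with hL
  have hL0 : 0 ≤ L := div_nonneg hK (by linarith)
  have hKL : K ≤ L * (1 - ζ) := by rw [hL, div_mul_cancel₀ _ (by linarith)]
  have hKL' : K ≤ L := hKL.trans (mul_le_of_le_one_right hL0 (by linarith))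
  -- The class with constant 4L = L + 3L is mapped by N + 1 steps to constant at most L + 3L/3 = 2L;
  -- subtracting a multiple of m doubles this back to 4L.
  obtain ⟨N, hN₀, hN⟩ : ∃ N ≥ N₀, ζ ^ (N + 1) ≤ 1 / 3 := by
    have := (tendsto_pow_atTop_nhds_zero_of_lt_one hζ hζ').eventually_le_const
      (u := (1 / 3 : ℝ)) (by norm_num)
    obtain ⟨N, h1, h2⟩ := (((tendsto_add_atTop_nat 1).eventually this).and (eventually_ge_atTop N₀)).exists
    exact ⟨N, h2, h1⟩
  set d := distortionFactor ζ (4 * L) 1 with hd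
  have hd0 : d ≠ 0 := distortionFactor_ne_zero
  have hdt : d ≠ ∞ := distortionFactor_ne_top
  have hlow (l : List ι → ℝ≥0∞) (hl : IsRegular ζ (4 * L) m l) (w : List ι) :
      2 * (ε / (2 * d) * l [] * m w) ≤ push (N + 1) l w := by
    have := hl.le_push hm (hε N hN₀) w
    calc _ = 2 / 2 * (ε * (l [] * m w) / d) := by
          simp only [div_eq_mul_inv, ENNReal.mul_inv (Or.inl two_ne_zero) (Or.inl ENNReal.ofNat_ne_top)]
          ring
      _ = ε * (l [] * m w) / d := by rw [ENNReal.div_self two_ne_zero ENNReal.ofNat_ne_top, one_mul]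
      _ ≤ _ := ENNReal.div_le_of_le_mul' this
  have hreg (u : List ι) : IsRegular ζ (4 * L) m fun w => m (u ++ w) := by
    refine IsRegular.mono hζ (by linarith : K ≤ 4 * L) ⟨fun w => ?_, fun w hw => ?_, ?_, hJ u⟩
    · simpa using hm.consistent (u ++ w)
    · simpa [hw] using hqb u w
    · exact hm.ne_top _
  set e := ε / (2 * d) with he
  have he0 : e ≠ 0 := by
    rw [he]; simp [hε0, ENNReal.mul_eq_top, hdt]
  -- Taking l = m and the empty word in the lower bound gives e ≤ 1/2, so that r = 1 − e is neither
  -- zero nor ill-defined.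
  have he2 : 2 * e ≤ 1 := by
    have h := hlow _ (hreg []) []
    rw [(hreg []).push_nil] at h
    simpa [hm.nil] using h
  have het : e ≠ ∞ := by
    intro h; simp [h] at he2
  have he1 : e ≤ 1 := le_trans (by rw [two_mul]; exact le_self_add) he2
  set r := 1 - e with hr
  have her : e + r = 1 := add_tsub_cancel_of_le he1
  have hdec (l : List ι → ℝ≥0∞) (hl : IsRegular ζ (4 * L) m l) :
      (∀ w, e * l [] * m w ≤ push (N + 1) l w) ∧
        IsRegular ζ (4 * L) m fun w => push (N + 1) l w - e * l [] * m w := by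
    refine ⟨fun w => le_trans (by rw [two_mul]; exact le_self_add) (hlow l hl w), ?_⟩
    have h1 : IsRegular ζ (L + 3 * L) m l := hl.mono hζ (by linarith)
    have h2 := (h1.push hm hζ hJ hKL (N + 1)).mono hζ (L := 2 * L) (by nlinarith)
    have h3 := h2.sub hm hζ (by positivity) (ENNReal.mul_ne_top het hl.ne_top) (hlow l hl)
    exact h3.mono hζ (by linarith)
  -- The term d·C is needed for the one-step bound; the extra C covers n = 0, where only
  -- quasi-independence is available.
  set A := d * C + C with hA
  have hAt : A ≠ ∞ := ENNReal.add_ne_top.2 ⟨ENNReal.mul_ne_top hdt hC, hC⟩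
  have hmain := IsRegular.push_mul_add_one_le hm her (A := A) (ζ := ζ) (K := 4 * L) (N := N + 1)
    (fun l hl w => (hl.push_one_le hm hqb w).trans (by gcongr; exact le_self_add)) hdec
  have hall (u : List ι) (n : ℕ) (w : List ι) :
      push n (fun w => m (u ++ w)) w ≤ (1 + A * r ^ ((n - 1) / (N + 1))) * (m u * m w) := by
    rcases n with _ | n
    · refine (hqb u w).trans ?_
      simp only [zero_tsub, Nat.zero_div, pow_zero, mul_one]
      gcongr
      rw [hA, ← add_assoc]
      exact le_add_self
    · rw [Nat.add_sub_cancel]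
      -- The leftover n % (N + 1) steps are harmless because `push` fixes m.
      have hn : n + 1 = ((N + 1) * (n / (N + 1)) + 1) + n % (N + 1) := by
        have := Nat.div_add_mod n (N + 1); omega
      calc _ = push (n % (N + 1)) (push ((N + 1) * (n / (N + 1)) + 1) fun w => m (u ++ w)) w := by
            rw [push_push, ← hn]
        _ ≤ push (n % (N + 1)) (fun w => (1 + A * r ^ (n / (N + 1))) * m u * m w) w := by
            refine push_le (fun w => ?_) _ _
            simpa [mul_assoc] using hmain (n / (N + 1)) _ (hreg u) w
        _ = _ := by rw [push_const_mul, hm.push_eq, mul_assoc]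
  have hrt : r ≠ ∞ := ne_top_of_le_ne_top ENNReal.one_ne_top (her ▸ le_add_self)
  have hr1 : r < 1 := ENNReal.sub_lt_self ENNReal.one_ne_top one_ne_zero he0
  have hr0 : r ≠ 0 := by
    intro h
    rw [h, add_zero] at her
    rw [her] at he2
    norm_num at he2
  have hr0' : 0 < r.toReal := ENNReal.toReal_pos hr0 hrt
  have hr1' : r.toReal < 1 := by
    simpa using (ENNReal.toReal_lt_toReal hrt ENNReal.one_ne_top).2 hr1
  obtain ⟨ρ, hρ0, hρ1, hρ⟩ := exists_pow_div_le hr0' hr1' (Nat.succ_ne_zero N)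
  refine ⟨A.toReal * r.toReal⁻¹ * ρ⁻¹ + 1, ρ, by positivity, hρ0, hρ1, fun u n w => ?_⟩
  refine (hall u n w).trans (mul_le_mul' ?_ le_rfl)
  have hk : ρ ^ (n - 1) ≤ ρ⁻¹ * ρ ^ n := by
    rcases n with _ | n
    · simpa using (one_le_inv₀ hρ0).2 hρ1.le
    · rw [Nat.add_sub_cancel, pow_succ, mul_comm, mul_assoc, mul_inv_cancel₀ hρ0.ne', mul_one]
  rw [← ENNReal.ofReal_toReal (ENNReal.add_ne_top.2 ⟨ENNReal.one_ne_top,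
    ENNReal.mul_ne_top hAt (ENNReal.pow_ne_top hrt)⟩)]
  refine ENNReal.ofReal_le_ofReal ?_
  rw [ENNReal.toReal_add ENNReal.one_ne_top (ENNReal.mul_ne_top hAt (ENNReal.pow_ne_top hrt)),
    ENNReal.toReal_mul, ENNReal.toReal_pow, ENNReal.toReal_one]
  refine add_le_add le_rfl ?_
  calc A.toReal * r.toReal ^ ((n - 1) / (N + 1))
      ≤ A.toReal * (r.toReal⁻¹ * (ρ⁻¹ * ρ ^ n)) := by
        gcongr
        exact (hρ (n - 1)).trans (by gcongr)
    _ = A.toReal * r.toReal⁻¹ * ρ⁻¹ * ρ ^ n := by ring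
    _ ≤ _ := by gcongr; linarith

/-! ### Exponential decay of cylinders -/

/-- If no symbol has full weight, the weights of words decay exponentially. -/
theorem IsMixing.exists_le_pow {m : List ι → ℝ≥0∞} (hm : IsMixing m) {B ρ : ℝ} (hB : 0 < B)
    (hρ : 0 < ρ) (hρ' : ρ < 1) (h : ∀ u n w,
      push n (fun w => m (u ++ w)) w ≤ ENNReal.ofReal (1 + B * ρ ^ n) * (m u * m w))
    (hone : ∀ a, m [a] ≠ 1) :
    ∃ B' ρ' : ℝ, 0 < B' ∧ 0 < ρ' ∧ ρ' < 1 ∧ ∀ w, m w ≤ ENNReal.ofReal (B' * ρ' ^ w.length) := by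
  have hsum : ∑' a, m [a] = 1 := by simpa [hm.nil] using hm.consistent []
  -- Any letter other than a₀ has mass at most 1 − m[a₀], so two numbers bound all letters uniformly
  -- below one.
  obtain ⟨τ, hτ1, hτ⟩ : ∃ τ : ℝ≥0∞, τ < 1 ∧ ∀ a, m [a] ≤ τ := by
    obtain ⟨a₀, ha₀⟩ : ∃ a, m [a] ≠ 0 := by
      by_contra! h
      simp [h] at hsum
    refine ⟨max (m [a₀]) (1 - m [a₀]), max_lt (lt_of_le_of_ne (hm.le_one _) (hone _))
      (ENNReal.sub_lt_self ENNReal.one_ne_top one_ne_zero ha₀), fun a => ?_⟩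
    by_cases e : a = a₀
    · subst e; exact le_max_left _ _
    · refine le_max_of_le_right (ENNReal.le_sub_of_add_le_right (hm.ne_top _) ?_)
      rw [← hsum]
      classical
      calc m [a] + m [a₀] = ∑ b ∈ {a, a₀}, m [b] := (Finset.sum_pair (f := fun b => m [b]) e).symm
        _ ≤ _ := ENNReal.sum_le_tsum _
  have hτt : τ ≠ ∞ := hτ1.ne_top
  obtain ⟨k, hk⟩ : ∃ k : ℕ, (1 + B * ρ ^ k) * τ.toReal < 1 := by
    have ht : Tendsto (fun k : ℕ => (1 + B * ρ ^ k) * τ.toReal) atTop (𝓝 ((1 + B * 0) * τ.toReal)) :=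
      (((tendsto_pow_atTop_nhds_zero_of_lt_one hρ.le hρ').const_mul B).const_add 1).mul_const _
    refine (ht.eventually_lt_const ?_).exists
    have : τ.toReal < 1 := by
      simpa using (ENNReal.toReal_lt_toReal hτt ENNReal.one_ne_top).2 hτ1
    simpa using this
  set x := max ((1 + B * ρ ^ k) * τ.toReal) (1 / 2) with hx
  have hx0 : 0 < x := lt_max_of_lt_right (by norm_num)
  have hx1 : x < 1 := max_lt hk (by norm_num)
  -- In each block of k + 1 letters the first k are forgotten, and serve as a mixing gap; the last
  -- one contributes a factor at most (1 + Bρᵏ)τ ≤ x < 1.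
  have step (u v : List ι) (hv : v.length = k + 1) : m (u ++ v) ≤ ENNReal.ofReal x * m u := by
    obtain ⟨v', b, rfl⟩ : ∃ v' b, v = v' ++ [b] := by
      rcases List.eq_nil_or_concat v with rfl | ⟨L, b, rfl⟩
      · simp at hv
      · exact ⟨L, b, by simp⟩
    have hv' : v'.length = k := by simpa using hv
    calc m (u ++ (v' ++ [b])) ≤ push k (fun w => m (u ++ w)) [b] := by
          rw [← hv']; exact le_wsum (fun v => m (u ++ (v ++ [b]))) v'
      _ ≤ ENNReal.ofReal (1 + B * ρ ^ k) * (m u * τ) :=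
          (h u k [b]).trans (by gcongr; exact hτ b)
      _ = ENNReal.ofReal ((1 + B * ρ ^ k) * τ.toReal) * m u := by
          rw [ENNReal.ofReal_mul (by positivity), ENNReal.ofReal_toReal hτt]; ring
      _ ≤ _ := by gcongr; exact le_max_left _ _
  have hpow (j : ℕ) (w : List ι) (hw : j * (k + 1) ≤ w.length) : m w ≤ ENNReal.ofReal (x ^ j) := by
    induction j generalizing w with
    | zero => simpa using hm.le_one w
    | succ j ih =>
      have hlen : (w.take (w.length - (k + 1))).length = w.length - (k + 1) := by simp
      have hle : k + 1 ≤ w.length := le_trans (by nlinarith) hw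
      rw [← List.take_append_drop (w.length - (k + 1)) w]
      refine (step _ _ (by rw [List.length_drop]; omega)).trans ?_
      rw [pow_succ, ENNReal.ofReal_mul (by positivity), mul_comm]
      gcongr
      exact ih _ (by rw [hlen]; rw [Nat.succ_mul] at hw; omega)
  obtain ⟨ρ', h0, h1, h2⟩ := exists_pow_div_le hx0 hx1 (Nat.succ_ne_zero k)
  exact ⟨x⁻¹, ρ', by positivity, h0, h1, fun w => (hpow (w.length / (k + 1)) w
    (Nat.div_mul_le_self _ _)).trans (ENNReal.ofReal_le_ofReal (h2 _))⟩

end WordWeight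

open Filter Topology MeasureTheory
open scoped ENNReal

/-! ### Cylinders of the interval map -/

namespace IntervalMap

variable {ι : Type*} {α β : ℝ} {T : ℝ → ℝ} {I : ι → Set ℝ} {φ : ℝ → ℝ} {μ : Measure ℝ}

/-- The cylinder of a word, given as a list. -/
def cyl (T : ℝ → ℝ) (I : ι → Set ℝ) : List ι → Set ℝ
  | [] => Set.univ
  | a :: w => I a ∩ T ⁻¹' cyl T I w

theorem mem_cyl_cons {a : ι} {w : List ι} {x : ℝ} :
    x ∈ cyl T I (a :: w) ↔ x ∈ I a ∧ T x ∈ cyl T I w := Iff.rfl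

theorem mem_cyl_append {u w : List ι} {x : ℝ} :
    x ∈ cyl T I (u ++ w) ↔ x ∈ cyl T I u ∧ T^[u.length] x ∈ cyl T I w := by
  induction u generalizing x with
  | nil => simp [cyl]
  | cons a u ih => simp only [List.cons_append, mem_cyl_cons, ih, List.length_cons,
      Function.iterate_succ_apply, and_assoc]

theorem cyl_append (u w : List ι) :
    cyl T I (u ++ w) = cyl T I u ∩ T^[u.length] ⁻¹' cyl T I w :=
  Set.ext fun _ => mem_cyl_append

theorem cyl_singleton (a : ι) : cyl T I [a] = I a := by simp [cyl]

theorem cyl_append_singleton (u : List ι) (a : ι) :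
    cyl T I (u ++ [a]) = cyl T I u ∩ T^[u.length] ⁻¹' I a := by
  rw [cyl_append, cyl_singleton]

theorem eq_of_mem_cyl (hdisj : Pairwise fun j k => Disjoint (I j) (I k)) {u v : List ι}
    (huv : u.length = v.length) {x : ℝ} (hu : x ∈ cyl T I u) (hv : x ∈ cyl T I v) : u = v := by
  induction u generalizing v x with
  | nil => exact (List.length_eq_zero_iff.1 huv.symm).symm
  | cons a u ih =>
    rcases v with _ | ⟨b, v⟩
    · simp at huv
    rw [mem_cyl_cons] at hu hv
    have hab : a = b := by
      by_contra h
      exact (hdisj h).le_bot ⟨hu.1, hv.1⟩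
    rw [hab, ih (by simpa using huv) hu.2 hv.2]

theorem iterate_mem_repeller (hT : Set.MapsTo T (Set.Icc α β) (Set.Icc α β)) {x : ℝ}
    (hx : x ∈ repeller α β T I) (n : ℕ) : T^[n] x ∈ repeller α β T I :=
  ⟨hT.iterate n hx.1, fun k => by rw [← Function.iterate_add_apply]; exact hx.2 _⟩

theorem exists_mem_cyl (hT : Set.MapsTo T (Set.Icc α β) (Set.Icc α β)) {x : ℝ}
    (hx : x ∈ repeller α β T I) (n : ℕ) : ∃ w : List ι, w.length = n ∧ x ∈ cyl T I w := by
  induction n generalizing x with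
  | zero => exact ⟨[], rfl, trivial⟩
  | succ n ih =>
    obtain ⟨w, hw, hxw⟩ := ih (iterate_mem_repeller hT hx 1)
    obtain ⟨k, hk⟩ := hx.2 0
    exact ⟨k :: w, by simp [hw], hk, hxw⟩

theorem sameSymbol_of_mem_cyl {w : List ι} {x y : ℝ} (hx : x ∈ cyl T I w) (hy : y ∈ cyl T I w)
    {i : ℕ} (hi : i < w.length) : SameSymbol T I i x y := by
  induction w generalizing x y i with
  | nil => simp at hi
  | cons a w ih =>
    rcases i with _ | i
    · exact ⟨a, hx.1, hy.1⟩
    · exact ih (i := i) hx.2 hy.2 (by simpa using hi)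

theorem mem_cyl_of_sameSymbol (hdisj : Pairwise fun j k => Disjoint (I j) (I k)) {w : List ι}
    {x y : ℝ} (hx : x ∈ cyl T I w) (h : ∀ i < w.length, SameSymbol T I i x y) : y ∈ cyl T I w := by
  induction w generalizing x y with
  | nil => trivial
  | cons a w ih =>
    refine ⟨?_, ih hx.2 fun i hi => h (i + 1) (by simpa using hi)⟩
    obtain ⟨k, hk, hk'⟩ := h 0 (by simp)
    have : a = k := by
      by_contra hne
      exact (hdisj hne).le_bot ⟨hx.1, hk⟩
    rwa [this]

theorem cylinderAt_eq (hdisj : Pairwise fun j k => Disjoint (I j) (I k)) {w : List ι} {x : ℝ}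
    (hx : x ∈ cyl T I w) : cylinderAt α β T I w.length x = Set.Icc α β ∩ cyl T I w :=
  Set.ext fun _ => ⟨fun hy => ⟨hy.1, mem_cyl_of_sameSymbol hdisj hx hy.2⟩,
    fun hy => ⟨hy.1, fun _ hi => sameSymbol_of_mem_cyl hx hy.2 hi⟩⟩

/-- On each partition element T is continuous and injective, hence strictly monotone on every
compact subinterval, and monotone preimages of intervals are intervals. -/
theorem IsPiecewiseExpanding.ordConnected_cyl (hT : IsPiecewiseExpanding α β T I)
    (hinj : ∀ k, Set.InjOn T (I k)) (w : List ι) : (cyl T I w).OrdConnected := by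
  induction w with
  | nil => exact Set.ordConnected_univ
  | cons a w ih =>
    refine ⟨fun x hx y hy z hz => ?_⟩
    have hsub : Set.Icc x y ⊆ I a := (hT.interval a).out hx.1 hy.1
    have hxy : x ≤ y := hz.1.trans hz.2
    refine ⟨hsub hz, ?_⟩
    rcases ContinuousOn.strictMonoOn_of_injOn_Icc' hxy
      ((hT.differentiable a).continuousOn.mono hsub) ((hinj a).mono hsub) with h | h
    · exact ih.out hx.2 hy.2 ⟨h.monotoneOn ⟨le_rfl, hxy⟩ hz hz.1,
        h.monotoneOn hz ⟨hxy, le_rfl⟩ hz.2⟩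
    · exact ih.out hy.2 hx.2 ⟨h.antitoneOn hz ⟨hxy, le_rfl⟩ hz.2,
        h.antitoneOn ⟨le_rfl, hxy⟩ hz hz.1⟩

theorem measurableSet_cyl (hT : Measurable T) (hI : ∀ k, MeasurableSet (I k)) (w : List ι) :
    MeasurableSet (cyl T I w) := by
  induction w with
  | nil => exact MeasurableSet.univ
  | cons a w ih => exact (hI a).inter (hT ih)

theorem IsPiecewiseExpanding.measurableSet (hT : IsPiecewiseExpanding α β T I) (k : ι) :
    MeasurableSet (I k) := (hT.interval k).measurableSet

/-! ### The measures of cylinders as a mixing weight -/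

/-- Partition elements may be used to decompose the measure at any time. -/
theorem tsum_measure_inter [Countable ι] (hT : IsPiecewiseExpanding α β T I)
    (hμ : IsGibbsMeasure α β T I φ μ) {B : Set ℝ} (hB : MeasurableSet B) (n : ℕ) :
    ∑' a, μ (B ∩ T^[n] ⁻¹' I a) = μ B := by
  have hTm := hμ.invariant.measurable
  rw [← measure_iUnion (fun j k hjk => ?_) fun a => hB.inter ((hTm.iterate n) (hT.measurableSet a))]
  · refine measure_congr ?_
    filter_upwards [hμ.carried] with x hx
    refine propext ⟨fun h => ?_, fun h => ?_⟩
    · obtain ⟨a, ha⟩ := Set.mem_iUnion.1 h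
      exact ha.1
    · obtain ⟨k, hk⟩ := hx.2 n
      exact Set.mem_iUnion.2 ⟨k, h, hk⟩
  · exact ((hT.disjoint hjk).preimage _).mono Set.inter_subset_right Set.inter_subset_right

theorem wsum_measure_cyl [Countable ι] (hT : IsPiecewiseExpanding α β T I)
    (hμ : IsGibbsMeasure α β T I φ μ) {B : Set ℝ} (hB : MeasurableSet B) (u : List ι) (n : ℕ) :
    (WordWeight.wsum n fun v => μ (cyl T I (u ++ v) ∩ B)) = μ (cyl T I u ∩ B) := by
  induction n generalizing u with
  | zero => simp [WordWeight.wsum]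
  | succ n ih =>
    have hm := measurableSet_cyl hμ.invariant.measurable hT.measurableSet u
    rw [WordWeight.wsum, ← tsum_measure_inter hT hμ (hm.inter hB) u.length]
    refine tsum_congr fun a => ?_
    have := ih (u ++ [a])
    simp only [List.append_assoc, List.singleton_append] at this
    rw [this, cyl_append_singleton, Set.inter_right_comm]

theorem push_measure_cyl [Countable ι] (hT : IsPiecewiseExpanding α β T I)
    (hμ : IsGibbsMeasure α β T I φ μ) (u w : List ι) (n : ℕ) :
    WordWeight.push n (fun w => μ (cyl T I (u ++ w))) w =
      μ (cyl T I u ∩ T^[u.length + n] ⁻¹' cyl T I w) := by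
  have hB : MeasurableSet (T^[u.length + n] ⁻¹' cyl T I w) := (hμ.invariant.measurable.iterate _)
    (measurableSet_cyl hμ.invariant.measurable hT.measurableSet w)
  rw [← wsum_measure_cyl hT hμ hB u n]
  refine WordWeight.wsum_congr fun v hv => ?_
  beta_reduce
  rw [← List.append_assoc, cyl_append (u ++ v), List.length_append, hv]

theorem isMixing_measure_cyl [Countable ι] [IsProbabilityMeasure μ]
    (hT : IsPiecewiseExpanding α β T I) (hμ : IsGibbsMeasure α β T I φ μ) (hmix : IsMixing T μ) :
    WordWeight.IsMixing fun w => μ (cyl T I w) where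
  nil := by simp [cyl]
  consistent w := by
    have hm := measurableSet_cyl hμ.invariant.measurable hT.measurableSet w
    simp only [cyl_append_singleton]
    exact tsum_measure_inter hT hμ hm _
  invariant w := by
    have hm := measurableSet_cyl hμ.invariant.measurable hT.measurableSet w
    have hm' := hμ.invariant.measurable hm
    rw [← hμ.invariant.measure_preimage hm.nullMeasurableSet, ← tsum_measure_inter hT hμ hm' 0]
    exact tsum_congr fun a => by rw [cyl, Set.inter_comm]; rfl
  tendsto u w := by
    simp only [push_measure_cyl hT hμ]
    have hm := measurableSet_cyl hμ.invariant.measurable hT.measurableSet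
    have := (hmix _ _ (hm u) (hm w)).comp (tendsto_add_atTop_nat u.length)
    refine this.congr fun n => ?_
    simp [add_comm]

/-! ### Regularity of the Gibbs weights -/

/-- The Gibbs weight of a word: the supremum of the exponentials of the normalized Birkhoff sums. -/
noncomputable def gibbsWeight (α β : ℝ) (T : ℝ → ℝ) (I : ι → Set ℝ) (φ : ℝ → ℝ) (p : ℝ)
    (w : List ι) : ℝ≥0∞ :=
  ⨆ x ∈ repeller α β T I ∩ cyl T I w,
    ENNReal.ofReal (Real.exp (-(w.length * p) + birkhoffSum T φ w.length x))

theorem measureReal_cylinderAt [IsProbabilityMeasure μ] (hT : IsPiecewiseExpanding α β T I)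
    (hμ : IsGibbsMeasure α β T I φ μ) {w : List ι} {x : ℝ} (hx : x ∈ cyl T I w) :
    μ.real (cylinderAt α β T I w.length x) = μ.real (cyl T I w) := by
  rw [cylinderAt_eq hT.disjoint hx, measureReal_def, measureReal_def]
  congr 1
  refine measure_congr ?_
  filter_upwards [hμ.carried] with y hy
  exact propext ⟨fun h => h.2, fun h => ⟨hy.1, h⟩⟩

/-- The Gibbs inequality holds at every point of the cylinder in the repeller, so it survives the
supremum. A cylinder missing the repeller is null. -/
theorem exists_gibbsWeight_comparable [IsProbabilityMeasure μ] (hT : IsPiecewiseExpanding α β T I)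
    (hμ : IsGibbsMeasure α β T I φ μ) : ∃ c : ℝ≥0∞, c ≠ ∞ ∧ ∃ p,
      (∀ w, μ (cyl T I w) ≤ c * gibbsWeight α β T I φ p w) ∧
      ∀ w, gibbsWeight α β T I φ p w ≤ c * μ (cyl T I w) := by
  obtain ⟨c, hc, p, h⟩ := hμ.gibbs
  refine ⟨ENNReal.ofReal c, ENNReal.ofReal_ne_top, p, fun w => ?_, fun w => iSup₂_le fun x hx => ?_⟩
  · by_cases hne : (repeller α β T I ∩ cyl T I w).Nonempty
    · obtain ⟨x, hx⟩ := hne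
      have h2 := (h w.length x hx.1).2
      rw [measureReal_cylinderAt hT hμ hx.2, div_le_iff₀ (Real.exp_pos _)] at h2
      calc μ (cyl T I w) = ENNReal.ofReal (μ.real (cyl T I w)) :=
            (ofReal_measureReal).symm
        _ ≤ ENNReal.ofReal c *
            ENNReal.ofReal (Real.exp (-(w.length * p) + birkhoffSum T φ w.length x)) := by
          rw [← ENNReal.ofReal_mul hc.le]; exact ENNReal.ofReal_le_ofReal h2
        _ ≤ _ := by
          gcongr
          exact le_iSup₂ (f := fun x (_ : x ∈ repeller α β T I ∩ cyl T I w) =>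
            ENNReal.ofReal (Real.exp (-(w.length * p) + birkhoffSum T φ w.length x))) x hx
    · have : μ (cyl T I w) = 0 := by
        exact measure_mono_null (fun x hx hx' => hne ⟨x, hx', hx⟩) (ae_iff.1 hμ.carried)
      rw [this]; exact zero_le
  · have h1 := (h w.length x hx.1).1
    rw [measureReal_cylinderAt hT hμ hx.2, le_div_iff₀ (Real.exp_pos _), inv_mul_le_iff₀ hc] at h1
    rw [← ofReal_measureReal (μ := μ) (s := cyl T I w), ← ENNReal.ofReal_mul hc.le]
    exact ENNReal.ofReal_le_ofReal h1

/-- Birkhoff sums are additive along orbits, so suprema of their exponentials are submultiplicative.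
With comparability this makes μ quasi-independent from above. -/
theorem gibbsWeight_append_le (hT : IsPiecewiseExpanding α β T I) (p : ℝ) (u w : List ι) :
    gibbsWeight α β T I φ p (u ++ w) ≤ gibbsWeight α β T I φ p u * gibbsWeight α β T I φ p w := by
  refine iSup₂_le fun x hx => ?_
  have hx' := mem_cyl_append.1 hx.2
  have e : -(((u ++ w).length : ℝ) * p) + birkhoffSum T φ (u ++ w).length x =
      (-(u.length * p) + birkhoffSum T φ u.length x) +
        (-(w.length * p) + birkhoffSum T φ w.length (T^[u.length] x)) := by
    rw [List.length_append, birkhoffSum_add]; push_cast; ring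
  rw [e, Real.exp_add, ENNReal.ofReal_mul (Real.exp_pos _).le]
  exact mul_le_mul'
    (le_iSup₂ (f := fun x (_ : x ∈ repeller α β T I ∩ cyl T I u) =>
      ENNReal.ofReal (Real.exp (-(u.length * p) + birkhoffSum T φ u.length x))) x ⟨hx.1, hx'.1⟩)
    (le_iSup₂ (f := fun x (_ : x ∈ repeller α β T I ∩ cyl T I w) =>
      ENNReal.ofReal (Real.exp (-(w.length * p) + birkhoffSum T φ w.length x))) (T^[u.length] x)
      ⟨iterate_mem_repeller hT.mapsTo hx.1 _, hx'.2⟩)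

/-- By the Markov property, inverse branches are defined on whole cylinders. -/
theorem IsGibbsMarkov.exists_preimage (hT : IsGibbsMarkov α β T I) {u w : List ι} (hw : w ≠ [])
    {x y : ℝ} (hx : x ∈ cyl T I (u ++ w)) (hy : y ∈ repeller α β T I ∩ cyl T I w) :
    ∃ y' ∈ repeller α β T I ∩ cyl T I (u ++ w), T^[u.length] y' = y := by
  induction u generalizing x with
  | nil => exact ⟨y, hy, rfl⟩
  | cons a u ih =>
    obtain ⟨y₁, hy₁, rfl⟩ := ih hx.2
    obtain ⟨b, v, hbv⟩ := List.exists_cons_of_ne_nil (l := u ++ w) (by simp [hw])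
    have hxb : T x ∈ I b := by have : T x ∈ cyl T I (u ++ w) := hx.2; rw [hbv] at this; exact this.1
    have hyb : y₁ ∈ I b := by have := hy₁.2; rw [hbv] at this; exact this.1
    obtain ⟨y', hy', rfl⟩ := hT.markov a b ⟨T x, Set.mem_image_of_mem T hx.1, hxb⟩ hyb
    refine ⟨y', ⟨⟨hT.subset a hy', fun n => ?_⟩, hy', hy₁.2⟩, rfl⟩
    rcases n with _ | n
    · exact ⟨a, hy'⟩
    · exact hy₁.1.2 n

/-- At time i the two orbits still share |u| − i + |w| symbols, so the differences form a geometric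
series. The factor 1 − ζ^|u| keeps the partial sum exact enough for the induction. -/
theorem birkhoffSum_sub_le (hT : Set.MapsTo T (Set.Icc α β) (Set.Icc α β)) {M ζ : ℝ} (hM : 0 < M)
    (hζ : 0 < ζ) (hζ' : ζ < 1) (hφ : ∀ n : ℕ, 1 ≤ n →
      ∀ x ∈ repeller α β T I, ∀ y ∈ repeller α β T I,
        (∀ i < n, SameSymbol T I i x y) → |φ x - φ y| ≤ M * ζ ^ n)
    {u w : List ι} {x y : ℝ} (hx : x ∈ repeller α β T I ∩ cyl T I (u ++ w))
    (hy : y ∈ repeller α β T I ∩ cyl T I (u ++ w)) :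
    birkhoffSum T φ u.length x - birkhoffSum T φ u.length y ≤
      M / (1 - ζ) * (1 - ζ ^ u.length) * ζ ^ w.length := by
  induction u generalizing x y with
  | nil => simp
  | cons a u ih =>
    have h1 := ih ⟨iterate_mem_repeller hT hx.1 1, hx.2.2⟩ ⟨iterate_mem_repeller hT hy.1 1, hy.2.2⟩
    have h2 := (le_abs_self _).trans (hφ (a :: u ++ w).length (by simp) x hx.1 y hy.1
      fun i hi => sameSymbol_of_mem_cyl hx.2 hy.2 hi)
    rw [List.length_append, List.length_cons] at h2
    rw [List.length_cons, birkhoffSum_succ', birkhoffSum_succ']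
    have h3 : M * ζ ^ (u.length + 1 + w.length) ≤ M * ζ ^ u.length * ζ ^ w.length := by
      rw [mul_assoc, ← pow_add]
      exact mul_le_mul_of_nonneg_left (pow_le_pow_of_le_one hζ.le hζ'.le (by omega)) hM.le
    have h4 : M / (1 - ζ) * (1 - ζ ^ (u.length + 1)) * ζ ^ w.length =
        M / (1 - ζ) * (1 - ζ ^ u.length) * ζ ^ w.length + M * ζ ^ u.length * ζ ^ w.length := by
      have : 1 - ζ ≠ 0 := by linarith
      field_simp
      ring
    simp only [Function.iterate_one] at h1
    linarith

/-- For x in the cylinder of u w z and y in that of w z', the branch along u lifts y to y'.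
Exchanging (x, y) for (y', T^|u| x) changes the total exponent only by the Birkhoff sums of x and y'
over the first |u| steps, and both points begin with u w. -/
theorem IsGibbsMarkov.relHolder_gibbsWeight (hT : IsGibbsMarkov α β T I) {M ζ : ℝ} (hM : 0 < M)
    (hζ : 0 < ζ) (hζ' : ζ < 1) (hφ : ∀ n : ℕ, 1 ≤ n →
      ∀ x ∈ repeller α β T I, ∀ y ∈ repeller α β T I,
        (∀ i < n, SameSymbol T I i x y) → |φ x - φ y| ≤ M * ζ ^ n) (p : ℝ) (u : List ι) :
    WordWeight.RelHolder ζ (M / (1 - ζ)) (fun w => gibbsWeight α β T I φ p (u ++ w))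
      (gibbsWeight α β T I φ p) := by
  intro w z z' hw
  beta_reduce
  nth_rw 1 [gibbsWeight]
  nth_rw 1 [gibbsWeight]
  simp_rw [ENNReal.iSup_mul, ENNReal.mul_iSup]
  refine iSup₂_le fun x hx => iSup₂_le fun y hy => ?_
  have hx' := mem_cyl_append.1 hx.2
  obtain ⟨y', hy', rfl⟩ : ∃ y' ∈ repeller α β T I ∩ cyl T I (u ++ (w ++ z')), T^[u.length] y' = y := by
    have hxuw : x ∈ cyl T I (u ++ w) := mem_cyl_append.2 ⟨hx'.1, (mem_cyl_append.1 hx'.2).1⟩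
    have hy1 := mem_cyl_append.1 hy.2
    obtain ⟨y', hy', rfl⟩ := hT.exists_preimage hw hxuw ⟨hy.1, hy1.1⟩
    exact ⟨y', ⟨hy'.1, mem_cyl_append.2 ⟨(mem_cyl_append.1 hy'.2).1, hy.2⟩⟩, rfl⟩
  have hx1 : x ∈ cyl T I (u ++ w) := mem_cyl_append.2 ⟨hx'.1, (mem_cyl_append.1 hx'.2).1⟩
  have hy1 : y' ∈ cyl T I (u ++ w) :=
    mem_cyl_append.2 ⟨(mem_cyl_append.1 hy'.2).1, (mem_cyl_append.1 hy.2).1⟩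
  have hbirk := birkhoffSum_sub_le hT.mapsTo hM hζ hζ' hφ ⟨hx.1, hx1⟩ ⟨hy'.1, hy1⟩
  have hbirk' : birkhoffSum T φ u.length x ≤
      birkhoffSum T φ u.length y' + M / (1 - ζ) * ζ ^ w.length := by
    have h1 : M / (1 - ζ) * (1 - ζ ^ u.length) * ζ ^ w.length ≤ M / (1 - ζ) * ζ ^ w.length := by
      have h2 : 0 ≤ M / (1 - ζ) := div_nonneg hM.le (by linarith)
      have h3 : 0 < ζ ^ u.length := pow_pos hζ _
      refine mul_le_mul_of_nonneg_right (mul_le_of_le_one_right h2 (by linarith)) (by positivity)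
    linarith
  refine le_trans ?_ (mul_le_mul' le_rfl (mul_le_mul'
    (le_iSup₂ (f := fun x (_ : x ∈ repeller α β T I ∩ cyl T I (u ++ (w ++ z'))) =>
      ENNReal.ofReal (Real.exp (-((u ++ (w ++ z')).length * p) +
        birkhoffSum T φ (u ++ (w ++ z')).length x))) y' hy')
    (le_iSup₂ (f := fun x (_ : x ∈ repeller α β T I ∩ cyl T I (w ++ z)) =>
      ENNReal.ofReal (Real.exp (-((w ++ z).length * p) + birkhoffSum T φ (w ++ z).length x)))
      (T^[u.length] x) ⟨iterate_mem_repeller hT.mapsTo hx.1 _, hx'.2⟩)))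
  rw [WordWeight.distortionFactor, ← ENNReal.ofReal_mul (Real.exp_pos _).le,
    ← ENNReal.ofReal_mul (Real.exp_pos _).le, ← ENNReal.ofReal_mul (Real.exp_pos _).le,
    ← Real.exp_add, ← Real.exp_add, ← Real.exp_add]
  refine ENNReal.ofReal_le_ofReal (Real.exp_le_exp.2 ?_)
  rw [List.length_append (as := u), List.length_append (as := u), birkhoffSum_add, birkhoffSum_add]
  push_cast
  linarith

/-- Exponential `ψ`-mixing of the partition, from above. -/
theorem exists_measure_cyl_inter_le [Countable ι] [IsProbabilityMeasure μ]
    (hT : IsGibbsMarkov α β T I) (hφ : IsLocallyHolder α β T I φ)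
    (hμ : IsGibbsMeasure α β T I φ μ) (hmix : IsMixing T μ) :
    ∃ B ρ : ℝ, 0 < B ∧ 0 < ρ ∧ ρ < 1 ∧
      (∀ (u : List ι) (n : ℕ) (w : List ι), μ (cyl T I u ∩ T^[u.length + n] ⁻¹' cyl T I w) ≤
        ENNReal.ofReal (1 + B * ρ ^ n) * (μ (cyl T I u) * μ (cyl T I w))) ∧
      ((∀ k, μ (I k) ≠ 1) → ∃ B' ρ' : ℝ, 0 < B' ∧ 0 < ρ' ∧ ρ' < 1 ∧
        ∀ w : List ι, μ (cyl T I w) ≤ ENNReal.ofReal (B' * ρ' ^ w.length)) := by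
  have hm := isMixing_measure_cyl hT.toIsPiecewiseExpanding hμ hmix
  obtain ⟨M, hM, ζ, hζ, hζ', hφ⟩ := hφ
  obtain ⟨c, hc, p, h1, h2⟩ := exists_gibbsWeight_comparable hT.toIsPiecewiseExpanding hμ
  have hK : 0 ≤ M / (1 - ζ) := div_nonneg hM.le (by linarith)
  have hJ := hm.relHolder hζ.le hζ'.le hK hc h1 h2
    (hT.relHolder_gibbsWeight hM hζ hζ' hφ p)
  have hqb (u w : List ι) : μ (cyl T I (u ++ w)) ≤ c ^ 3 * (μ (cyl T I u) * μ (cyl T I w)) := by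
    calc _ ≤ c * gibbsWeight α β T I φ p (u ++ w) := h1 _
      _ ≤ c * (gibbsWeight α β T I φ p u * gibbsWeight α β T I φ p w) := by
        gcongr; exact gibbsWeight_append_le hT.toIsPiecewiseExpanding p u w
      _ ≤ c * ((c * μ (cyl T I u)) * (c * μ (cyl T I w))) := by gcongr <;> exact h2 _
      _ = _ := by ring
  obtain ⟨B, ρ, hB, hρ, hρ', h⟩ := hm.exists_push_le hζ.le hζ' (by positivity)
    (ENNReal.pow_ne_top hc) hqb hJ
  refine ⟨B, ρ, hB, hρ, hρ', fun u n w => ?_, fun hone => ?_⟩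
  · rw [← push_measure_cyl hT.toIsPiecewiseExpanding hμ]
    exact h u n w
  · exact hm.exists_le_pow hB hρ hρ' h fun a => by rw [cyl_singleton]; exact hone a

/-! ### The degenerate case: an element of full measure -/

theorem IsPiecewiseExpanding.monotoneOn_or_antitoneOn (hT : IsPiecewiseExpanding α β T I)
    (hinj : ∀ k, Set.InjOn T (I k)) (k : ι) : MonotoneOn T (I k) ∨ AntitoneOn T (I k) := by
  by_contra! h
  obtain ⟨a, ha, b, hb, c, hc, hab, hbc, h⟩ := Set.not_monotoneOn_not_antitoneOn_iff_exists_le_le.1 h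
  have hsub : Set.Icc a c ⊆ I k := (hT.interval k).out ha hc
  have hac := hab.trans hbc
  rcases ContinuousOn.strictMonoOn_of_injOn_Icc' hac
    ((hT.differentiable k).continuousOn.mono hsub) ((hinj k).mono hsub) with h' | h'
  · have h1 := h'.monotoneOn ⟨le_rfl, hac⟩ ⟨hab, hbc⟩ hab
    have h2 := h'.monotoneOn ⟨hab, hbc⟩ ⟨hac, le_rfl⟩ hbc
    rcases h with h | h <;> linarith [h.1, h.2]
  · have h1 := h'.antitoneOn ⟨le_rfl, hac⟩ ⟨hab, hbc⟩ hab
    have h2 := h'.antitoneOn ⟨hab, hbc⟩ ⟨hac, le_rfl⟩ hbc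
    rcases h with h | h <;> linarith [h.1, h.2]

/-- A measure-preserving map with almost surely monotone bounded orbits is the identity. -/
theorem ae_eq_of_monotone_orbits [IsProbabilityMeasure μ] {S : ℝ → ℝ} (hS : MeasurePreserving S μ μ)
    {a b : ℝ} (hbd : ∀ᵐ x ∂μ, ∀ n, S^[n] x ∈ Set.Icc a b)
    (hmono : ∀ᵐ x ∂μ, Monotone (fun n => S^[n] x) ∨ Antitone fun n => S^[n] x) :
    ∀ᵐ x ∂μ, S x = x := by
  have hSm := hS.measurable
  have hmeas (n : ℕ) : Measurable fun x => |S^[n + 1] x - S^[n] x| :=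
    ((hSm.iterate _).sub (hSm.iterate _)).abs
  -- By invariance the mean displacement is the same at every time, while monotone bounded orbits
  -- converge and force it to zero.
  have hint (n : ℕ) : ∫ x, |S^[n + 1] x - S^[n] x| ∂μ = ∫ x, |S x - x| ∂μ := by
    have h := (hS.iterate n).map_eq
    conv_rhs => rw [← h]
    rw [integral_map (f := fun x => |S x - x|) (hSm.iterate n).aemeasurable
      (hSm.sub measurable_id).abs.aestronglyMeasurable]
    simp only [Function.iterate_succ_apply']
  have hlim : Tendsto (fun n => ∫ x, |S^[n + 1] x - S^[n] x| ∂μ) atTop (𝓝 (∫ _, (0 : ℝ) ∂μ)) := by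
    refine tendsto_integral_of_dominated_convergence (fun _ => b - a)
      (fun n => (hmeas n).aestronglyMeasurable) (integrable_const _) (fun n => ?_) ?_
    · filter_upwards [hbd] with x hx
      rw [Real.norm_eq_abs, abs_abs, abs_le]
      have h1 := hx (n + 1)
      have h2 := hx n
      constructor <;> linarith [h1.1, h1.2, h2.1, h2.2]
    · filter_upwards [hbd, hmono] with x hx hm
      obtain ⟨l, hl⟩ : ∃ l, Tendsto (fun n => S^[n] x) atTop (𝓝 l) := by
        rcases hm with hm | hm
        · exact ⟨_, tendsto_atTop_ciSup hm ⟨b, by rintro _ ⟨n, rfl⟩; exact (hx n).2⟩⟩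
        · exact ⟨_, tendsto_atTop_ciInf hm ⟨a, by rintro _ ⟨n, rfl⟩; exact (hx n).1⟩⟩
      have := ((hl.comp (tendsto_add_atTop_nat 1)).sub hl).abs
      simpa using this
  simp only [hint, integral_zero] at hlim
  have h0 : ∫ x, |S x - x| ∂μ = 0 := tendsto_nhds_unique tendsto_const_nhds hlim
  have hi : Integrable (fun x => |S x - x|) μ := by
    refine Integrable.of_bound (hmeas 0).aestronglyMeasurable (b - a) ?_
    filter_upwards [hbd] with x hx
    rw [Real.norm_eq_abs, abs_abs, abs_le]
    have h1 : S x ∈ _ := hx 1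
    have h2 : x ∈ _ := hx 0
    constructor <;> linarith [h1.1, h1.2, h2.1, h2.2]
  rw [integral_eq_zero_iff_of_nonneg (fun x => abs_nonneg _) hi] at h0
  filter_upwards [h0] with x hx
  simpa [sub_eq_zero] using hx

/-- If one partition element has full measure, a mixing invariant measure is a Dirac mass. -/
theorem exists_eq_dirac_of_measure_eq_one [IsProbabilityMeasure μ]
    (hT : IsPiecewiseExpanding α β T I) (hinj : ∀ k, Set.InjOn T (I k))
    (hμ : IsGibbsMeasure α β T I φ μ) (hmix : IsMixing T μ) {k : ι} (hk : μ (I k) = 1) :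
    ∃ x₀, μ = Measure.dirac x₀ ∧ T x₀ = x₀ := by
  have hinv := hμ.invariant
  have hTm := hinv.measurable
  have hmem : ∀ᵐ x ∂μ, ∀ n, T^[n] x ∈ I k := by
    rw [ae_all_iff]
    intro n
    have : ∀ᵐ x ∂μ, x ∈ I k := by
      rw [← prob_compl_eq_zero_iff (hT.measurableSet k)] at hk
      exact hk
    exact (hinv.iterate n).quasiMeasurePreserving.ae this
  have hS : MeasurePreserving T^[2] μ μ := hinv.iterate 2
  have hid : ∀ᵐ x ∂μ, T^[2] x = x := by
    refine ae_eq_of_monotone_orbits hS (a := α) (b := β) ?_ ?_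
    · filter_upwards [hmem] with x hx n
      rw [← Function.iterate_mul]
      exact hT.subset k (hx _)
    · filter_upwards [hmem] with x hx
      -- T may reverse order, but T² preserves it along these orbits, so orbits of T² are monotone.
      have hmono (m n : ℕ) (h : T^[m] x ≤ T^[n] x) : T^[m + 2] x ≤ T^[n + 2] x := by
        simp only [Function.iterate_succ_apply']
        have h1 := hx m
        have h2 := hx n
        have h3 := hx (m + 1)
        have h4 := hx (n + 1)
        simp only [Function.iterate_succ_apply'] at h3 h4
        rcases hT.monotoneOn_or_antitoneOn hinj k with h' | h'
        · exact h' h3 h4 (h' h1 h2 h)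
        · exact h' h4 h3 (h' h1 h2 h)
      simp only [← Function.iterate_mul]
      rcases le_total (T^[0] x) (T^[2] x) with h | h
      · left
        refine monotone_nat_of_le_succ fun n => ?_
        induction n with
        | zero => exact h
        | succ n ih => exact hmono _ _ ih
      · right
        refine antitone_nat_of_succ_le fun n => ?_
        induction n with
        | zero => exact h
        | succ n ih => exact hmono _ _ ih
  have hidn : ∀ᵐ x ∂μ, ∀ n, T^[2 * n] x = x := by
    filter_upwards [hid] with x hx n
    rw [Function.iterate_mul]
    exact Function.iterate_fixed hx n
  -- T² is almost surely the identity, so mixing along even times reads μ(A) = μ(A)².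
  have : IsZeroOneMeasure μ := ⟨fun A hA => by
    have h1 := (hmix A A hA hA).comp (tendsto_id.const_mul_atTop' (r := 2) two_pos)
    have h2 (n : ℕ) : μ (A ∩ T^[2 * n] ⁻¹' A) = μ A := by
      refine measure_congr ?_
      filter_upwards [hidn] with x hx
      exact propext ⟨fun h => h.1, fun h => ⟨h, by rw [Set.mem_preimage, hx]; exact h⟩⟩
    have h3 : μ A = μ A * μ A :=
      tendsto_nhds_unique tendsto_const_nhds (h1.congr fun n => h2 n)
    by_cases h0 : μ A = 0
    · exact Or.inl h0
    · right
      exact ((ENNReal.mul_right_inj h0 (measure_ne_top μ A)).1 (by rw [mul_one]; exact h3)).symm⟩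
  obtain ⟨x₀, hx₀⟩ := IsZeroOneMeasure.exists_eq_dirac (μ := μ)
  refine ⟨x₀, hx₀, ?_⟩
  have h := hinv.measure_preimage (measurableSet_singleton x₀).nullMeasurableSet
  rw [hx₀, Measure.dirac_apply' _ (hTm (measurableSet_singleton x₀)),
    Measure.dirac_apply' _ (measurableSet_singleton x₀)] at h
  by_contra hne
  simp [Set.indicator, hne] at h

/-! ### From cylinders to Borel sets -/

theorem cyl_subset_of_mem (hdisj : Pairwise fun j k => Disjoint (I j) (I k)) {u w : List ι}
    (h : u.length ≤ w.length) {x : ℝ} (hu : x ∈ cyl T I u) (hw : x ∈ cyl T I w) :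
    cyl T I w ⊆ cyl T I u := by
  rw [← List.take_append_drop u.length w] at hw ⊢
  have : w.take u.length = u :=
    eq_of_mem_cyl hdisj (by simp [h]) (mem_cyl_append.1 hw).1 hu
  rw [this]
  exact fun y hy => (mem_cyl_append.1 hy).1

/-- Points are almost surely separated from all others by cylinders. -/
theorem ae_separated [Countable ι] (hT : IsPiecewiseExpanding α β T I)
    (hinj : ∀ k, Set.InjOn T (I k)) (hμ : IsGibbsMeasure α β T I φ μ) {B ρ : ℝ} (hρ : 0 < ρ)
    (hρ' : ρ < 1) (hdecay : ∀ w : List ι, μ (cyl T I w) ≤ ENNReal.ofReal (B * ρ ^ w.length)) :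
    ∀ᵐ x ∂μ, ∀ y, y ≠ x → ∃ w : List ι, x ∈ cyl T I w ∧ y ∉ cyl T I w := by
  -- The points with the itinerary of q lie in cylinders of arbitrarily small measure; only rational
  -- q will be needed, hence a countable union.
  have hnull (q : ℝ) (hq : q ∈ repeller α β T I) :
      μ {z | ∀ w : List ι, q ∈ cyl T I w → z ∈ cyl T I w} = 0 := by
    have ht : Tendsto (fun n : ℕ => ENNReal.ofReal (B * ρ ^ n)) atTop (𝓝 0) := by
      simpa using ENNReal.tendsto_ofReal
        ((tendsto_pow_atTop_nhds_zero_of_lt_one hρ.le hρ').const_mul B)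
    refine le_antisymm (ge_of_tendsto' ht fun n => ?_) zero_le
    obtain ⟨w, rfl, hw⟩ := exists_mem_cyl hT.mapsTo hq n
    refine le_trans (measure_mono fun z hz => ?_) (hdecay w)
    exact hz w hw
  have hall : ∀ᵐ x ∂μ, ∀ q : ℚ, (q : ℝ) ∈ repeller α β T I →
      ¬ ∀ w : List ι, (q : ℝ) ∈ cyl T I w → x ∈ cyl T I w := by
    rw [ae_all_iff]
    intro q
    by_cases hq : (q : ℝ) ∈ repeller α β T I
    · rw [ae_iff]
      simpa [hq] using hnull q hq
    · simp [hq]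
  filter_upwards [hall, hμ.carried] with x hx hxr y hy
  by_contra! h
  -- If y is not separated from x, every cylinder containing x contains the segment between them, so
  -- a rational there has the itinerary of x.
  obtain ⟨q, hq⟩ : ∃ q : ℚ, ∀ w : List ι, x ∈ cyl T I w → (q : ℝ) ∈ cyl T I w := by
    rcases lt_or_gt_of_ne hy with hlt | hlt
    · obtain ⟨q, h1, h2⟩ := exists_rat_btwn hlt
      exact ⟨q, fun w hw => (hT.ordConnected_cyl hinj w).out (h w hw) hw ⟨h1.le, h2.le⟩⟩
    · obtain ⟨q, h1, h2⟩ := exists_rat_btwn hlt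
      exact ⟨q, fun w hw => (hT.ordConnected_cyl hinj w).out hw (h w hw) ⟨h1.le, h2.le⟩⟩
  have hqr : (q : ℝ) ∈ repeller α β T I := by
    have hk (n : ℕ) : ∃ k, T^[n] (q : ℝ) ∈ I k := by
      obtain ⟨w, hw, hxw⟩ := exists_mem_cyl (I := I) hT.mapsTo hxr (n + 1)
      obtain ⟨k, _, hk⟩ := sameSymbol_of_mem_cyl hxw (hq w hxw) (i := n) (by omega)
      exact ⟨k, hk⟩
    obtain ⟨k, hk0⟩ := hk 0
    exact ⟨hT.subset k hk0, hk⟩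
  refine hx q hqr fun w hw => ?_
  obtain ⟨v, hv, hxv⟩ := exists_mem_cyl (I := I) hT.mapsTo hxr w.length
  rwa [eq_of_mem_cyl hT.disjoint hv.symm hw (hq v hxv)]

/-- Comparison of measures on cylinders extends to Borel sets. -/
theorem le_smul_of_cyl_le [Countable ι] [IsProbabilityMeasure μ] (hT : IsPiecewiseExpanding α β T I)
    (hinj : ∀ k, Set.InjOn T (I k)) (hμ : IsGibbsMeasure α β T I φ μ) {B ρ : ℝ} (hρ : 0 < ρ)
    (hρ' : ρ < 1) (hdecay : ∀ w : List ι, μ (cyl T I w) ≤ ENNReal.ofReal (B * ρ ^ w.length))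
    {ν : Measure ℝ} (hac : ν ≪ μ) {c : ℝ≥0∞} (hc : c ≠ ∞)
    (h : ∀ w : List ι, ν (cyl T I w) ≤ c * μ (cyl T I w)) : ν ≤ c • μ := by
  have hmeas := measurableSet_cyl (I := I) hμ.invariant.measurable hT.measurableSet
  have hsep := ae_separated hT hinj hμ hρ hρ' hdecay
  have hopen (U : Set ℝ) (hU : IsOpen U) : ν U ≤ c * μ U := by
    set W : ℕ → Set (List ι) := fun n => {w | w.length = n ∧ cyl T I w ⊆ U} with hW
    set V : ℕ → Set ℝ := fun n => repeller α β T I ∩ ⋃ w ∈ W n, cyl T I w with hV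
    have hVle (n : ℕ) : ν (V n) ≤ c * μ U := by
      have hd : (W n).PairwiseDisjoint (cyl T I) := fun u hu w hw hne =>
        Set.disjoint_left.2 fun x hxu hxw =>
          hne (eq_of_mem_cyl hT.disjoint (hu.1.trans hw.1.symm) hxu hxw)
      calc ν (V n) ≤ ν (⋃ w ∈ W n, cyl T I w) := measure_mono Set.inter_subset_right
        _ = ∑' w : W n, ν (cyl T I w) :=
          measure_biUnion (Set.to_countable _) hd fun w _ => hmeas w
        _ ≤ ∑' w : W n, c * μ (cyl T I w) := ENNReal.tsum_le_tsum fun w => h w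
        _ = c * μ (⋃ w ∈ W n, cyl T I w) := by
          rw [ENNReal.tsum_mul_left, measure_biUnion (Set.to_countable _) hd fun w _ => hmeas w]
        _ ≤ c * μ U := by
          gcongr
          exact Set.iUnion₂_subset fun w hw => hw.2
    have hVmono : Monotone V := by
      refine monotone_nat_of_le_succ fun n x hx => ⟨hx.1, ?_⟩
      obtain ⟨w, hw, hxw⟩ := Set.mem_iUnion₂.1 hx.2
      obtain ⟨k, hk⟩ := hx.1.2 n
      have hsub : cyl T I (w ++ [k]) ⊆ cyl T I w := fun y hy => (mem_cyl_append.1 hy).1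
      refine Set.mem_iUnion₂.2 ⟨w ++ [k], ⟨by simp [hw.1], hsub.trans hw.2⟩, ?_⟩
      rw [cyl_append_singleton]
      exact ⟨hxw, by rw [hw.1]; exact hk⟩
    -- A cylinder that contains x but neither x − δ/2 nor x + δ/2 is an interval inside the δ-ball.
    -- So almost every point of U lies in a cylinder contained in U.
    have hUV : ν U ≤ ν (⋃ n, V n) := by
      refine measure_mono_ae (hac.ae_le ?_)
      filter_upwards [hsep, hμ.carried] with x hx hxr hxU
      obtain ⟨δ, hδ, hball⟩ := Metric.isOpen_iff.1 hU x hxU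
      obtain ⟨w₁, h1, h1'⟩ := hx (x - δ / 2) (by linarith)
      obtain ⟨w₂, h2, h2'⟩ := hx (x + δ / 2) (by linarith)
      obtain ⟨w, hw, hxw⟩ := exists_mem_cyl (I := I) hT.mapsTo hxr (max w₁.length w₂.length)
      refine Set.mem_iUnion.2 ⟨_, hxr, Set.mem_iUnion₂.2 ⟨w, ⟨hw, fun z hz => hball ?_⟩, hxw⟩⟩
      have hs1 := cyl_subset_of_mem hT.disjoint (hw ▸ le_max_left _ _) h1 hxw
      have hs2 := cyl_subset_of_mem hT.disjoint (hw ▸ le_max_right _ _) h2 hxw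
      have hord := hT.ordConnected_cyl hinj w
      rw [Metric.mem_ball, Real.dist_eq, abs_lt]
      constructor
      · by_contra! hle
        exact h1' (hs1 (hord.out hz hxw ⟨by linarith, by linarith⟩))
      · by_contra! hle
        exact h2' (hs2 (hord.out hxw hz ⟨by linarith, by linarith⟩))
    refine hUV.trans ?_
    rw [hVmono.measure_iUnion]
    exact iSup_le hVle
  have : IsFiniteMeasure (c • μ) := Measure.smul_finite μ hc
  rw [Measure.le_iff]
  intro s _
  -- Outer regularity is needed for the finite measure c • μ only.
  rw [Set.measure_eq_iInf_isOpen s (c • μ)]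
  refine le_iInf₂ fun U hsU => le_iInf fun hU => ?_
  exact (measure_mono hsU).trans (by simpa using hopen U hU)

/-- Exponential `ψ`-mixing from above between cylinders and Borel sets. -/
theorem map_restrict_cyl_le [Countable ι] [IsProbabilityMeasure μ]
    (hT : IsPiecewiseExpanding α β T I) (hinj : ∀ k, Set.InjOn T (I k))
    (hμ : IsGibbsMeasure α β T I φ μ) {B ρ : ℝ} (hρ : 0 < ρ)
    (hρ' : ρ < 1) (hdecay : ∀ w : List ι, μ (cyl T I w) ≤ ENNReal.ofReal (B * ρ ^ w.length))
    {c : ℝ≥0∞} (hc : c ≠ ∞) {u : List ι} {n : ℕ}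
    (h : ∀ w : List ι, μ (cyl T I u ∩ T^[n] ⁻¹' cyl T I w) ≤ c * (μ (cyl T I u) * μ (cyl T I w))) :
    (μ.restrict (cyl T I u)).map T^[n] ≤ (c * μ (cyl T I u)) • μ := by
  have hTm := hμ.invariant.measurable.iterate n
  have hmeas := measurableSet_cyl (I := I) hμ.invariant.measurable hT.measurableSet
  refine le_smul_of_cyl_le hT hinj hμ hρ hρ' hdecay ?_
    (ENNReal.mul_ne_top hc (measure_ne_top _ _)) fun w => ?_
  · refine (Measure.map_mono Measure.restrict_le_self hTm).absolutelyContinuous.trans ?_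
    rw [(hμ.invariant.iterate n).map_eq]
  · rw [Measure.map_apply hTm (hmeas w), Measure.restrict_apply (hTm (hmeas w)), Set.inter_comm,
      mul_assoc]
    exact h w

/-! ### Decomposition of variations and integrals over cylinders -/

/-- Variations over disjoint intervals add up to at most the total variation. -/
theorem sum_eVariationOn_le {κ : Type*} (f : ℝ → ℝ) (S : κ → Set ℝ) (hS : ∀ k, (S k).OrdConnected)
    (s : Finset κ) (hd : (s : Set κ).PairwiseDisjoint S) :
    ∑ k ∈ s, eVariationOn f (S k) ≤ eVariationOn f (⋃ k ∈ s, S k) := by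
  classical
  -- One point of each set orders the disjoint intervals from left to right, and the induction adds
  -- the rightmost last. The value 0 for an empty set plays no role.
  set r : κ → ℝ := fun k => if h : (S k).Nonempty then h.some else 0 with hr
  have hrmem {k : κ} (h : (S k).Nonempty) : r k ∈ S k := by
    simp only [hr, dif_pos h]; exact h.some_mem
  induction s using Finset.induction_on_max_value r with
  | empty => simp
  | insert a s has hmax ih =>
    have hd' : (s : Set κ).PairwiseDisjoint S := hd.subset (by simp)
    rw [Finset.sum_insert has, Finset.set_biUnion_insert, Set.union_comm, add_comm]
    refine le_trans (add_le_add (ih hd') le_rfl) (eVariationOn.add_le_union f ?_)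
    intro x hx y hy
    obtain ⟨k, hk, hxk⟩ := Set.mem_iUnion₂.1 hx
    have hne : k ≠ a := fun h => has (h ▸ hk)
    have hdisj : Disjoint (S k) (S a) :=
      hd (by simp [hk]) (by simp) hne
    have hrk := hrmem ⟨x, hxk⟩
    have hra := hrmem ⟨y, hy⟩
    by_contra! hlt
    rcases le_or_gt (r k) y with h | h
    · exact hdisj.le_bot ⟨(hS k).out hrk hxk ⟨h, hlt.le⟩, hy⟩
    · exact hdisj.le_bot ⟨hrk, (hS a).out hy hra ⟨h.le, hmax k hk⟩⟩

theorem tsum_eVariationOn_le {κ : Type*} (f : ℝ → ℝ) (S : κ → Set ℝ) (hS : ∀ k, (S k).OrdConnected)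
    (hd : Pairwise fun j k => Disjoint (S j) (S k)) {X : Set ℝ} (hX : ∀ k, S k ⊆ X) :
    ∑' k, eVariationOn f (S k) ≤ eVariationOn f X := by
  rw [ENNReal.tsum_eq_iSup_sum]
  exact iSup_le fun s => (sum_eVariationOn_le f S hS s fun j _ k _ h => hd h).trans
    (eVariationOn.mono f (Set.iUnion₂_subset fun k _ => hX k))

theorem pairwise_disjoint_cyl (hdisj : Pairwise fun j k => Disjoint (I j) (I k)) (N : ℕ) :
    Pairwise fun u v : {w : List ι // w.length = N} => Disjoint (cyl T I u.1) (cyl T I v.1) :=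
  fun u v huv => Set.disjoint_left.2 fun _ hu hv =>
    huv (Subtype.ext (eq_of_mem_cyl hdisj (u.2.trans v.2.symm) hu hv))

theorem restrict_iUnion_cyl (hT : IsPiecewiseExpanding α β T I) (hμ : IsGibbsMeasure α β T I φ μ)
    (N : ℕ) : μ.restrict (⋃ w : {w : List ι // w.length = N}, cyl T I w.1) = μ := by
  refine Measure.restrict_eq_self_of_ae_mem ?_
  filter_upwards [hμ.carried] with x hx
  obtain ⟨w, hw, hxw⟩ := exists_mem_cyl (I := I) hT.mapsTo hx N
  exact Set.mem_iUnion.2 ⟨⟨w, hw⟩, hxw⟩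

theorem lintegral_eq_tsum_cyl [Countable ι] (hT : IsPiecewiseExpanding α β T I)
    (hμ : IsGibbsMeasure α β T I φ μ) (N : ℕ) (h : ℝ → ℝ≥0∞) :
    ∫⁻ x, h x ∂μ = ∑' w : {w : List ι // w.length = N}, ∫⁻ x in cyl T I w.1, h x ∂μ := by
  conv_lhs => rw [← restrict_iUnion_cyl hT hμ N]
  exact lintegral_iUnion (fun w => measurableSet_cyl hμ.invariant.measurable hT.measurableSet _)
    (pairwise_disjoint_cyl hT.disjoint N) _

/-! ### Decorrelation for functions constant on cylinders -/

/-- Functions that are constant on the cylinders of a given length. -/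
def ConstOnCyl {E : Type*} (T : ℝ → ℝ) (I : ι → Set ℝ) (N : ℕ) (F : ℝ → E) : Prop :=
  ∃ Φ : List ι → E, ∀ w : List ι, w.length = N → ∀ x ∈ cyl T I w, F x = Φ w

theorem ConstOnCyl.aemeasurable [Countable ι] {F : ℝ → ℝ} {N : ℕ} (hF : ConstOnCyl T I N F)
    (hT : IsPiecewiseExpanding α β T I) (hμ : IsGibbsMeasure α β T I φ μ) : AEMeasurable F μ := by
  obtain ⟨Φ, hΦ⟩ := hF
  rw [← restrict_iUnion_cyl hT hμ N, aemeasurable_iUnion_iff]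
  intro w
  refine (aemeasurable_const (b := Φ w.1)).congr ?_
  filter_upwards [ae_restrict_mem (measurableSet_cyl hμ.invariant.measurable hT.measurableSet w.1)]
    with x hx
  exact (hΦ w.1 w.2 x hx).symm

theorem ConstOnCyl.comp {E E' : Type*} {F : ℝ → E} {N : ℕ} (hF : ConstOnCyl T I N F) (g : E → E') :
    ConstOnCyl T I N fun x => g (F x) := by
  obtain ⟨Φ, hΦ⟩ := hF
  exact ⟨fun w => g (Φ w), fun w hw x hx => congrArg g (hΦ w hw x hx)⟩

/-- On one cylinder F is a constant and the integral of G∘Tⁿ is an integral of G against the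
pushed-forward restriction of μ; the bounds then add up. -/
theorem lintegral_mul_comp_iterate_le [Countable ι] (hT : IsPiecewiseExpanding α β T I)
    (hμ : IsGibbsMeasure α β T I φ μ) {N n : ℕ} {c : ℝ≥0∞}
    (hc : ∀ u : List ι, u.length = N →
      (μ.restrict (cyl T I u)).map T^[n] ≤ (c * μ (cyl T I u)) • μ)
    {F G : ℝ → ℝ≥0∞} (hF : ConstOnCyl T I N F) (hG : AEMeasurable G μ) :
    ∫⁻ x, F x * G (T^[n] x) ∂μ ≤ c * ((∫⁻ x, F x ∂μ) * ∫⁻ x, G x ∂μ) := by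
  obtain ⟨Φ, hΦ⟩ := hF
  have hmeas := measurableSet_cyl (I := I) hμ.invariant.measurable hT.measurableSet
  have hGn : AEMeasurable (fun x => G (T^[n] x)) μ :=
    hG.comp_quasiMeasurePreserving (hμ.invariant.iterate n).quasiMeasurePreserving
  rw [lintegral_eq_tsum_cyl hT hμ N, lintegral_eq_tsum_cyl hT hμ N F, ← ENNReal.tsum_mul_right,
    ← ENNReal.tsum_mul_left]
  refine ENNReal.tsum_le_tsum fun w => ?_
  have h1 : ∫⁻ x in cyl T I w.1, F x * G (T^[n] x) ∂μ =
      Φ w.1 * ∫⁻ x in cyl T I w.1, G (T^[n] x) ∂μ := by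
    rw [← lintegral_const_mul'' _ hGn.restrict]
    exact setLIntegral_congr_fun (hmeas w.1) fun x hx => by rw [hΦ w.1 w.2 x hx]
  have h2 : ∫⁻ x in cyl T I w.1, F x ∂μ = Φ w.1 * μ (cyl T I w.1) := by
    rw [← setLIntegral_const]
    exact setLIntegral_congr_fun (hmeas w.1) fun x hx => hΦ w.1 w.2 x hx
  have h3 : ∫⁻ x in cyl T I w.1, G (T^[n] x) ∂μ ≤ c * μ (cyl T I w.1) * ∫⁻ x, G x ∂μ := by
    have hmap := hc w.1 w.2
    have hac : (μ.restrict (cyl T I w.1)).map T^[n] ≪ μ :=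
      hmap.absolutelyContinuous.trans Measure.smul_absolutelyContinuous
    rw [← lintegral_map' (hG.mono_ac hac) (hμ.invariant.measurable.iterate n).aemeasurable,
      ← smul_eq_mul (c * μ _), ← lintegral_smul_measure]
    exact lintegral_mono' hmap le_rfl
  rw [h1, h2]
  calc _ ≤ Φ w.1 * (c * μ (cyl T I w.1) * ∫⁻ x, G x ∂μ) := by gcongr
    _ = _ := by ring

/-- Covariance is unchanged by adding constants. Applied to the nonnegative F + A and G + M, the
multiplicative bound leaves an excess δ ∫(F + A) ∫(G + M) ≤ 4AMδ. -/
theorem integral_mul_comp_iterate_sub_le [Countable ι] [IsProbabilityMeasure μ]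
    (hT : IsPiecewiseExpanding α β T I)
    (hμ : IsGibbsMeasure α β T I φ μ) {N n : ℕ} {δ : ℝ} (hδ : 0 ≤ δ)
    (hc : ∀ u : List ι, u.length = N →
      (μ.restrict (cyl T I u)).map T^[n] ≤ (ENNReal.ofReal (1 + δ) * μ (cyl T I u)) • μ)
    {F G : ℝ → ℝ} {A M : ℝ} (hF : ConstOnCyl T I N F) (hFA : ∀ᵐ x ∂μ, |F x| ≤ A)
    (hG : AEMeasurable G μ) (hGM : ∀ᵐ x ∂μ, |G x| ≤ M) :
    (∫ x, F x * G (T^[n] x) ∂μ) - (∫ x, F x ∂μ) * ∫ x, G x ∂μ ≤ 4 * A * M * δ := by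
  have hFm := hF.aemeasurable hT hμ
  have hqmp := (hμ.invariant.iterate n).quasiMeasurePreserving
  have hGn : AEMeasurable (fun x => G (T^[n] x)) μ := hG.comp_quasiMeasurePreserving hqmp
  have hGnM : ∀ᵐ x ∂μ, |G (T^[n] x)| ≤ M := hqmp.ae hGM
  have iF : Integrable F μ := Integrable.of_bound hFm.aestronglyMeasurable A hFA
  have iG : Integrable G μ := Integrable.of_bound hG.aestronglyMeasurable M hGM
  have iGn : Integrable (fun x => G (T^[n] x)) μ :=
    Integrable.of_bound hGn.aestronglyMeasurable M hGnM
  have iFG : Integrable (fun x => F x * G (T^[n] x)) μ :=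
    iGn.bdd_mul hFm.aestronglyMeasurable hFA
  have hinv : ∫ x, G (T^[n] x) ∂μ = ∫ x, G x ∂μ := by
    have h := (hμ.invariant.iterate n).map_eq
    rw [← integral_map (hμ.invariant.measurable.iterate n).aemeasurable
      (by rw [h]; exact hG.aestronglyMeasurable), h]
  have iF' : Integrable (fun x => F x + A) μ := iF.add (integrable_const _)
  have iG' : Integrable (fun x => G x + M) μ := iG.add (integrable_const _)
  have e1 : (fun x => (F x + A) * (G (T^[n] x) + M)) =
      fun x => (F x * G (T^[n] x) + M * F x) + (A * G (T^[n] x) + A * M) := by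
    funext x; ring
  have i1 : Integrable (fun x => F x * G (T^[n] x) + M * F x) μ := iFG.add (iF.const_mul M)
  have i2 : Integrable (fun x => A * G (T^[n] x) + A * M) μ :=
    (iGn.const_mul A).add (integrable_const _)
  have iP : Integrable (fun x => (F x + A) * (G (T^[n] x) + M)) μ := by
    rw [e1]; exact i1.add i2
  have nF : ∀ᵐ x ∂μ, 0 ≤ F x + A := by
    filter_upwards [hFA] with x hx
    linarith [(abs_le.1 hx).1]
  have nG : ∀ᵐ x ∂μ, 0 ≤ G x + M := by
    filter_upwards [hGM] with x hx
    linarith [(abs_le.1 hx).1]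
  have nGn : ∀ᵐ x ∂μ, 0 ≤ G (T^[n] x) + M := hqmp.ae nG
  have eP : ∫ x, (F x + A) * (G (T^[n] x) + M) ∂μ =
      ∫ x, F x * G (T^[n] x) ∂μ + M * ∫ x, F x ∂μ + (A * ∫ x, G x ∂μ + A * M) := by
    rw [e1, integral_add i1 i2, integral_add iFG (iF.const_mul M), integral_add (iGn.const_mul A)
      (integrable_const _), integral_const_mul, integral_const_mul, hinv]
    simp
  have eF : ∫ x, (F x + A) ∂μ = ∫ x, F x ∂μ + A := by
    rw [integral_add iF (integrable_const _)]; simp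
  have eG : ∫ x, (G x + M) ∂μ = ∫ x, G x ∂μ + M := by
    rw [integral_add iG (integrable_const _)]; simp
  have hF0 : 0 ≤ ∫ x, F x ∂μ + A := eF ▸ integral_nonneg_of_ae nF
  have hG0 : 0 ≤ ∫ x, G x ∂μ + M := eG ▸ integral_nonneg_of_ae nG
  have key : ∫ x, (F x + A) * (G (T^[n] x) + M) ∂μ ≤
      (1 + δ) * ((∫ x, F x ∂μ + A) * (∫ x, G x ∂μ + M)) := by
    have h := lintegral_mul_comp_iterate_le hT hμ hc
      (hF.comp fun t => ENNReal.ofReal (t + A)) (hG.add_const M).ennreal_ofReal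
    rw [← ofReal_integral_eq_lintegral_ofReal iF' nF, ← ofReal_integral_eq_lintegral_ofReal iG' nG,
      eF, eG, ← ENNReal.ofReal_mul hF0, ← ENNReal.ofReal_mul (by linarith)] at h
    refine (ENNReal.ofReal_le_ofReal_iff (mul_nonneg (by linarith) (mul_nonneg hF0 hG0))).1
      (le_trans (le_of_eq ?_) h)
    have nP : ∀ᵐ x ∂μ, 0 ≤ (F x + A) * (G (T^[n] x) + M) := by
      filter_upwards [nF, nGn] with x h1 h2
      exact mul_nonneg h1 h2
    rw [ofReal_integral_eq_lintegral_ofReal iP nP]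
    refine lintegral_congr_ae ?_
    filter_upwards [nF] with x hx
    exact ENNReal.ofReal_mul hx
  have bF : ∫ x, F x ∂μ + A ≤ 2 * A := by
    have := (le_abs_self _).trans (norm_integral_le_of_norm_le_const (μ := μ) (f := F) hFA)
    simp at this; linarith
  have bG : ∫ x, G x ∂μ + M ≤ 2 * M := by
    have := (le_abs_self _).trans (norm_integral_le_of_norm_le_const (μ := μ) (f := G) hGM)
    simp at this; linarith
  have hprod : (∫ x, F x ∂μ + A) * (∫ x, G x ∂μ + M) ≤ 2 * A * (2 * M) :=
    mul_le_mul bF bG hG0 (hF0.trans bF)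
  rw [eP] at key
  nlinarith [mul_le_mul_of_nonneg_left hprod hδ]

/-- Replacing F by −F turns the upper bound into a lower one, so ψ-mixing from above suffices. -/
theorem abs_integral_mul_comp_iterate_sub_le [Countable ι] [IsProbabilityMeasure μ]
    (hT : IsPiecewiseExpanding α β T I)
    (hμ : IsGibbsMeasure α β T I φ μ) {N n : ℕ} {δ : ℝ} (hδ : 0 ≤ δ)
    (hc : ∀ u : List ι, u.length = N →
      (μ.restrict (cyl T I u)).map T^[n] ≤ (ENNReal.ofReal (1 + δ) * μ (cyl T I u)) • μ)
    {F G : ℝ → ℝ} {A M : ℝ} (hF : ConstOnCyl T I N F) (hFA : ∀ᵐ x ∂μ, |F x| ≤ A)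
    (hG : AEMeasurable G μ) (hGM : ∀ᵐ x ∂μ, |G x| ≤ M) :
    |(∫ x, F x * G (T^[n] x) ∂μ) - (∫ x, F x ∂μ) * ∫ x, G x ∂μ| ≤ 4 * A * M * δ := by
  refine abs_le.2 ⟨?_, integral_mul_comp_iterate_sub_le hT hμ hδ hc hF hFA hG hGM⟩
  have h := integral_mul_comp_iterate_sub_le hT hμ hδ hc (hF.comp Neg.neg)
    (by simpa using hFA) hG hGM
  simp only [neg_mul, integral_neg] at h
  linarith

/-! ### Approximation of functions of bounded variation -/

open Classical in
/-- The value of `f` at a point of `X` in the cylinder of `w`. -/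
noncomputable def cylValue (α β : ℝ) (T : ℝ → ℝ) (I : ι → Set ℝ) (f : ℝ → ℝ) (w : List ι) : ℝ :=
  if h : (Set.Icc α β ∩ cyl T I w).Nonempty then f h.some else 0

open Classical in
/-- The approximation of `f` by a function that is constant on the cylinders of length `N`. -/
noncomputable def cylApprox (α β : ℝ) (T : ℝ → ℝ) (I : ι → Set ℝ) (f : ℝ → ℝ) (N : ℕ) (x : ℝ) : ℝ :=
  if h : ∃ w : List ι, w.length = N ∧ x ∈ cyl T I w then cylValue α β T I f h.choose else 0

theorem cylApprox_eq (hdisj : Pairwise fun j k => Disjoint (I j) (I k)) {f : ℝ → ℝ} {w : List ι}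
    {N : ℕ} (hw : w.length = N) {x : ℝ} (hx : x ∈ cyl T I w) :
    cylApprox α β T I f N x = cylValue α β T I f w := by
  have h : ∃ w : List ι, w.length = N ∧ x ∈ cyl T I w := ⟨w, hw, hx⟩
  rw [cylApprox, dif_pos h, eq_of_mem_cyl hdisj (h.choose_spec.1.trans hw.symm) h.choose_spec.2 hx]

theorem abs_cylValue_le {f : ℝ → ℝ} {A : ℝ} (hA : 0 ≤ A) (hf : ∀ x ∈ Set.Icc α β, |f x| ≤ A)
    (w : List ι) : |cylValue α β T I f w| ≤ A := by
  rw [cylValue]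
  split_ifs with h
  · exact hf _ h.some_mem.1
  · simpa

theorem abs_cylApprox_le {f : ℝ → ℝ} {A : ℝ} (hA : 0 ≤ A) (hf : ∀ x ∈ Set.Icc α β, |f x| ≤ A)
    (N : ℕ) (x : ℝ) : |cylApprox α β T I f N x| ≤ A := by
  rw [cylApprox]
  split_ifs with h
  · exact abs_cylValue_le hA hf _
  · simpa

theorem constOnCyl_cylApprox (hdisj : Pairwise fun j k => Disjoint (I j) (I k)) (f : ℝ → ℝ) (N : ℕ) :
    ConstOnCyl T I N (cylApprox α β T I f N) :=
  ⟨cylValue α β T I f, fun _ hw _ hx => cylApprox_eq hdisj hw hx⟩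

/-- `L¹` approximation of functions of bounded variation. -/
theorem lintegral_edist_cylApprox_le [Countable ι] (hT : IsPiecewiseExpanding α β T I)
    (hinj : ∀ k, Set.InjOn T (I k)) (hμ : IsGibbsMeasure α β T I φ μ) {N : ℕ} {c : ℝ≥0∞}
    (hc : ∀ w : List ι, w.length = N → μ (cyl T I w) ≤ c) (f : ℝ → ℝ) :
    ∫⁻ x, edist (f x) (cylApprox α β T I f N x) ∂μ ≤ c * eVariationOn f (Set.Icc α β) := by
  have hmeas := measurableSet_cyl (I := I) hμ.invariant.measurable hT.measurableSet
  set S : {w : List ι // w.length = N} → Set ℝ := fun w => Set.Icc α β ∩ cyl T I w.1 with hS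
  calc ∫⁻ x, edist (f x) (cylApprox α β T I f N x) ∂μ
      = ∑' w : {w : List ι // w.length = N},
          ∫⁻ x in cyl T I w.1, edist (f x) (cylApprox α β T I f N x) ∂μ :=
        lintegral_eq_tsum_cyl hT hμ N _
    _ ≤ ∑' w : {w : List ι // w.length = N}, c * eVariationOn f (S w) := by
        refine ENNReal.tsum_le_tsum fun w => ?_
        calc _ ≤ ∫⁻ x in cyl T I w.1, eVariationOn f (S w) ∂μ := by
              refine lintegral_mono_ae ?_
              filter_upwards [ae_restrict_mem (hmeas w.1), ae_restrict_of_ae hμ.carried] with x hx hxr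
              have hne : (S w).Nonempty := ⟨x, hxr.1, hx⟩
              rw [cylApprox_eq hT.disjoint w.2 hx, cylValue, dif_pos hne]
              exact eVariationOn.edist_le f ⟨hxr.1, hx⟩ hne.some_mem
          _ = eVariationOn f (S w) * μ (cyl T I w.1) := setLIntegral_const _ _
          _ ≤ _ := by rw [mul_comm]; gcongr; exact hc _ w.2
    _ = c * ∑' w, eVariationOn f (S w) := ENNReal.tsum_mul_left
    _ ≤ _ := by
        gcongr
        refine tsum_eVariationOn_le f S (fun w => ?_) (fun u v huv => ?_)
          fun w => Set.inter_subset_left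
        · exact Set.ordConnected_Icc.inter (hT.ordConnected_cyl hinj _)
        · exact (pairwise_disjoint_cyl hT.disjoint N huv).mono Set.inter_subset_right
            Set.inter_subset_right

theorem aemeasurable_of_boundedVariationOn {f : ℝ → ℝ} (hf : BoundedVariationOn f (Set.Icc α β))
    (h : ∀ᵐ x ∂μ, x ∈ Set.Icc α β) : AEMeasurable f μ := by
  obtain ⟨p, q, hp, hq, rfl⟩ := hf.locallyBoundedVariationOn.exists_monotoneOn_sub_monotoneOn
  rw [← Measure.restrict_eq_self_of_ae_mem h]
  exact (aemeasurable_restrict_of_monotoneOn measurableSet_Icc hp).sub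
    (aemeasurable_restrict_of_monotoneOn measurableSet_Icc hq)

theorem integral_abs_sub_cylApprox_le [Countable ι] [IsProbabilityMeasure μ]
    (hT : IsPiecewiseExpanding α β T I)
    (hinj : ∀ k, Set.InjOn T (I k)) (hμ : IsGibbsMeasure α β T I φ μ) {N : ℕ} {c V : ℝ} (hc0 : 0 ≤ c)
    (hV0 : 0 ≤ V)
    (hc : ∀ w : List ι, w.length = N → μ (cyl T I w) ≤ ENNReal.ofReal c) {f : ℝ → ℝ}
    (hV : eVariationOn f (Set.Icc α β) ≤ ENNReal.ofReal V) :
    Integrable (fun x => |f x - cylApprox α β T I f N x|) μ ∧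
      ∫ x, |f x - cylApprox α β T I f N x| ∂μ ≤ c * V := by
  have hbv : BoundedVariationOn f (Set.Icc α β) := ne_top_of_le_ne_top ENNReal.ofReal_ne_top hV
  have hfm : AEMeasurable f μ :=
    aemeasurable_of_boundedVariationOn hbv (hμ.carried.mono fun x hx => hx.1)
  have hm : AEMeasurable (fun x => f x - cylApprox α β T I f N x) μ :=
    hfm.sub ((constOnCyl_cylApprox hT.disjoint f N).aemeasurable hT hμ)
  have h := (lintegral_edist_cylApprox_le hT hinj hμ hc f).trans (mul_le_mul' le_rfl hV)
  simp only [edist_eq_enorm_sub] at h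
  rw [← ENNReal.ofReal_mul hc0] at h
  have hi : Integrable (fun x => f x - cylApprox α β T I f N x) μ :=
    ⟨hm.aestronglyMeasurable, h.trans_lt ENNReal.ofReal_lt_top⟩
  refine ⟨hi.abs, ?_⟩
  rw [← ofReal_integral_norm_eq_lintegral_enorm hi,
    ENNReal.ofReal_le_ofReal_iff (mul_nonneg hc0 hV0)] at h
  exact h

/-! ### Decorrelation of bounded variation observables -/

/-- Decorrelation of `f₁ · f₂ ∘ Tᵃ` from the future, with explicit constants. -/
theorem decorrelation [Countable ι] [IsProbabilityMeasure μ]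
    (hT : IsPiecewiseExpanding α β T I) (hinj : ∀ k, Set.InjOn T (I k))
    (hμ : IsGibbsMeasure α β T I φ μ) {m n a : ℕ} {c δ A V M : ℝ} (hc0 : 0 ≤ c) (hδ : 0 ≤ δ)
    (hA : 0 ≤ A) (hV0 : 0 ≤ V) (hM : 0 ≤ M)
    (hc : ∀ w : List ι, w.length = m → μ (cyl T I w) ≤ ENNReal.ofReal c)
    (hψ : ∀ u : List ι, u.length = a + m →
      (μ.restrict (cyl T I u)).map T^[a + m + n] ≤ (ENNReal.ofReal (1 + δ) * μ (cyl T I u)) • μ)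
    {f₁ f₂ G : ℝ → ℝ} (h1 : ∀ x ∈ Set.Icc α β, |f₁ x| ≤ A) (h2 : ∀ x ∈ Set.Icc α β, |f₂ x| ≤ A)
    (hV1 : eVariationOn f₁ (Set.Icc α β) ≤ ENNReal.ofReal V)
    (hV2 : eVariationOn f₂ (Set.Icc α β) ≤ ENNReal.ofReal V)
    (hG : AEMeasurable G μ) (hGM : ∀ᵐ x ∂μ, |G x| ≤ M) :
    |(∫ x, f₁ x * f₂ (T^[a] x) * G (T^[a + m + n] x) ∂μ) -
      (∫ x, f₁ x * f₂ (T^[a] x) ∂μ) * ∫ x, G x ∂μ| ≤ 4 * A ^ 2 * M * δ + 4 * A * M * V * c := by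
  have hX : ∀ᵐ x ∂μ, x ∈ Set.Icc α β := hμ.carried.mono fun x hx => hx.1
  have hpa := hμ.invariant.iterate a
  have hqa := hpa.quasiMeasurePreserving
  have hqb := (hμ.invariant.iterate (a + m + n)).quasiMeasurePreserving
  set p₁ := cylApprox α β T I f₁ m with hp₁
  set p₂ := cylApprox α β T I f₂ m with hp₂
  have hp₁A (x : ℝ) : |p₁ x| ≤ A := abs_cylApprox_le hA h1 m x
  have hp₂A (x : ℝ) : |p₂ x| ≤ A := abs_cylApprox_le hA h2 m x
  have hf₁m : AEMeasurable f₁ μ := aemeasurable_of_boundedVariationOn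
    (ne_top_of_le_ne_top ENNReal.ofReal_ne_top hV1) hX
  have hf₂m : AEMeasurable f₂ μ := aemeasurable_of_boundedVariationOn
    (ne_top_of_le_ne_top ENNReal.ofReal_ne_top hV2) hX
  set F : ℝ → ℝ := fun x => f₁ x * f₂ (T^[a] x) with hF
  set P : ℝ → ℝ := fun x => p₁ x * p₂ (T^[a] x) with hP
  -- p₁ reads the letters 0 to m − 1 and p₂∘Tᵃ the letters a to a + m − 1, so a + m letters
  -- determine P.
  have hPc : ConstOnCyl T I (a + m) P := by
    refine ⟨fun w => cylValue α β T I f₁ (w.take m) * cylValue α β T I f₂ (w.drop a),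
      fun w hw x hx => ?_⟩
    have e1 : x ∈ cyl T I (w.take m) := by
      rw [← List.take_append_drop m w] at hx
      exact (mem_cyl_append.1 hx).1
    have e2 : T^[a] x ∈ cyl T I (w.drop a) := by
      rw [← List.take_append_drop a w] at hx
      have := (mem_cyl_append.1 hx).2
      rwa [List.length_take, hw, min_eq_left (by omega)] at this
    rw [hP]
    beta_reduce
    rw [hp₁, hp₂, cylApprox_eq hT.disjoint (by simp [hw]) e1,
      cylApprox_eq hT.disjoint (by simp [hw]) e2]
  have hPA : ∀ᵐ x ∂μ, |P x| ≤ A ^ 2 := Eventually.of_forall fun x => by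
    rw [hP, abs_mul, sq]
    exact mul_le_mul (hp₁A x) (hp₂A _) (abs_nonneg _) hA
  have hFA : ∀ᵐ x ∂μ, |F x| ≤ A ^ 2 := by
    filter_upwards [hX, hqa.ae hX] with x hx hx'
    rw [hF, abs_mul, sq]
    exact mul_le_mul (h1 x hx) (h2 _ hx') (abs_nonneg _) hA
  have main := abs_integral_mul_comp_iterate_sub_le hT hμ hδ hψ hPc hPA hG hGM
  have hPm := hPc.aemeasurable hT hμ
  have hFm : AEMeasurable F μ := hf₁m.mul (hf₂m.comp_quasiMeasurePreserving hqa)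
  have hGb : AEMeasurable (fun x => G (T^[a + m + n] x)) μ := hG.comp_quasiMeasurePreserving hqb
  have hGbM : ∀ᵐ x ∂μ, |G (T^[a + m + n] x)| ≤ M := hqb.ae hGM
  obtain ⟨i1, b1⟩ := integral_abs_sub_cylApprox_le hT hinj hμ hc0 hV0 hc hV1
  obtain ⟨i2, b2⟩ := integral_abs_sub_cylApprox_le hT hinj hμ hc0 hV0 hc hV2
  have i2' : Integrable (fun x => |f₂ (T^[a] x) - p₂ (T^[a] x)|) μ := hpa.integrable_comp_of_integrable i2
  have b2' : ∫ x, |f₂ (T^[a] x) - p₂ (T^[a] x)| ∂μ ≤ c * V := by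
    refine le_of_eq_of_le ?_ b2
    have h := hpa.map_eq
    rw [← integral_map (f := fun x => |f₂ x - p₂ x|) hpa.measurable.aemeasurable
      (by rw [h]; exact i2.aestronglyMeasurable), h]
  have iF : Integrable F μ := Integrable.of_bound hFm.aestronglyMeasurable _ hFA
  have iP : Integrable P μ := Integrable.of_bound hPm.aestronglyMeasurable _ hPA
  have iG : Integrable G μ := Integrable.of_bound hG.aestronglyMeasurable _ hGM
  have iGb : Integrable (fun x => G (T^[a + m + n] x)) μ :=
    Integrable.of_bound hGb.aestronglyMeasurable _ hGbM
  have hFP : ∫ x, |F x - P x| ∂μ ≤ 2 * A * V * c := by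
    calc ∫ x, |F x - P x| ∂μ
        ≤ ∫ x, (A * |f₁ x - p₁ x| + A * |f₂ (T^[a] x) - p₂ (T^[a] x)|) ∂μ := by
          refine integral_mono_ae (iF.sub iP).abs ((i1.const_mul A).add (i2'.const_mul A)) ?_
          filter_upwards [hqa.ae hX] with x hx'
          have e : F x - P x = f₂ (T^[a] x) * (f₁ x - p₁ x) +
              p₁ x * (f₂ (T^[a] x) - p₂ (T^[a] x)) := by
            simp only [hF, hP]; ring
          rw [e]
          refine (abs_add_le _ _).trans ?_
          rw [abs_mul, abs_mul]
          exact add_le_add (mul_le_mul_of_nonneg_right (h2 _ hx') (abs_nonneg _))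
            (mul_le_mul_of_nonneg_right (hp₁A x) (abs_nonneg _))
      _ = A * ∫ x, |f₁ x - p₁ x| ∂μ + A * ∫ x, |f₂ (T^[a] x) - p₂ (T^[a] x)| ∂μ := by
          rw [integral_add (i1.const_mul A) (i2'.const_mul A), integral_const_mul,
            integral_const_mul]
      _ ≤ A * (c * V) + A * (c * V) := add_le_add (mul_le_mul_of_nonneg_left b1 hA)
          (mul_le_mul_of_nonneg_left b2' hA)
      _ = _ := by ring
  -- Replacing F by P costs 2AMVc in the joint integral and as much in the product of integrals.
  have d1 : |(∫ x, F x * G (T^[a + m + n] x) ∂μ) - ∫ x, P x * G (T^[a + m + n] x) ∂μ| ≤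
      M * (2 * A * V * c) := by
    rw [← integral_sub (iGb.bdd_mul hFm.aestronglyMeasurable hFA)
      (iGb.bdd_mul hPm.aestronglyMeasurable hPA)]
    refine (abs_integral_le_integral_abs).trans ?_
    refine le_trans ?_ (mul_le_mul_of_nonneg_left hFP hM)
    rw [← integral_const_mul]
    refine integral_mono_ae ((iGb.bdd_mul hFm.aestronglyMeasurable hFA).sub
      (iGb.bdd_mul hPm.aestronglyMeasurable hPA)).abs ((iF.sub iP).abs.const_mul M) ?_
    filter_upwards [hGbM] with x hx
    rw [← sub_mul, abs_mul, mul_comm]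
    exact mul_le_mul_of_nonneg_right hx (abs_nonneg _)
  have d2 : |(∫ x, F x ∂μ) * (∫ x, G x ∂μ) - (∫ x, P x ∂μ) * ∫ x, G x ∂μ| ≤
      M * (2 * A * V * c) := by
    rw [← sub_mul, abs_mul, mul_comm]
    have hGi : |∫ x, G x ∂μ| ≤ M := by
      have := norm_integral_le_of_norm_le_const (μ := μ) (f := G) hGM
      simpa using this
    refine mul_le_mul hGi ?_ (abs_nonneg _) hM
    rw [← integral_sub iF iP]
    exact abs_integral_le_integral_abs.trans hFP
  rw [abs_le] at d1 d2 main ⊢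
  constructor <;> linarith [d1.1, d1.2, d2.1, d2.2, main.1, main.2]

/-- Exponential decorrelation of `f₁ · f₂ ∘ Tᵃ` from the future, uniformly in the observables. -/
theorem exists_exponential_decorrelation [Countable ι] [IsProbabilityMeasure μ]
    (hT : IsGibbsMarkov α β T I) (hφ : IsLocallyHolder α β T I φ)
    (hμ : IsGibbsMeasure α β T I φ μ) (hmix : IsMixing T μ) (hone : ∀ k, μ (I k) ≠ 1) :
    ∃ κ K : ℝ, 0 < κ ∧ 0 ≤ K ∧ ∀ A V M : ℝ, 0 ≤ A → 0 ≤ V → 0 ≤ M → ∀ f₁ f₂ G : ℝ → ℝ,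
      (∀ x ∈ Set.Icc α β, |f₁ x| ≤ A) → (∀ x ∈ Set.Icc α β, |f₂ x| ≤ A) →
      eVariationOn f₁ (Set.Icc α β) ≤ ENNReal.ofReal V →
      eVariationOn f₂ (Set.Icc α β) ≤ ENNReal.ofReal V →
      AEMeasurable G μ → (∀ᵐ x ∂μ, |G x| ≤ M) → ∀ a b : ℕ, a < b →
        |(∫ x, f₁ x * f₂ (T^[a] x) * G (T^[b] x) ∂μ) -
          (∫ x, f₁ x * f₂ (T^[a] x) ∂μ) * ∫ x, G x ∂μ| ≤
            A * M * (A + V) * K * Real.exp (-κ * ((b : ℝ) - a)) := by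
  obtain ⟨B, ρ, hB, hρ, hρ', hψ, hdecay⟩ := exists_measure_cyl_inter_le hT hφ hμ hmix
  obtain ⟨B', ρ', hB', hr, hr', hd⟩ := hdecay hone
  set r := max ρ ρ' with hrdef
  have hr0 : 0 < r := lt_max_of_lt_left hρ
  have hr1 : r < 1 := max_lt hρ' hr'
  obtain ⟨s, hs0, hs1, hs⟩ := WordWeight.exists_pow_div_le hr0 hr1 two_ne_zero
  refine ⟨-Real.log s, 4 * (B + B') * r⁻¹, neg_pos.2 (Real.log_neg hs0 hs1), by positivity,
    fun A V M hA hV hM f₁ f₂ G h1 h2 hV1 hV2 hG hGM a b hab => ?_⟩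
  obtain ⟨d, rfl⟩ := Nat.exists_eq_add_of_le hab.le
  -- The gap d = b − a is split: d/2 letters for the approximation and the remaining n ≥ d/2 steps
  -- for mixing. This halves the rate, whence the square root s of r.
  obtain ⟨n, hn⟩ : ∃ n, a + d = a + d / 2 + n := ⟨d - d / 2, by omega⟩
  have hexp : Real.exp (-(-Real.log s) * (((a + d : ℕ) : ℝ) - a)) = s ^ d := by
    rw [neg_neg, Nat.cast_add, add_sub_cancel_left, mul_comm, Real.exp_nat_mul, Real.exp_log hs0]
  have hmain := decorrelation (m := d / 2) (n := n) (a := a) (c := B' * ρ' ^ (d / 2))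
    (δ := B * ρ ^ n) hT.toIsPiecewiseExpanding hT.injective hμ (by positivity) (by positivity)
    hA hV hM (fun w hw => hw ▸ hd w)
    (fun u hu => map_restrict_cyl_le hT.toIsPiecewiseExpanding hT.injective hμ hr hr' hd
      ENNReal.ofReal_ne_top fun w => hu ▸ hψ u n w) h1 h2 hV1 hV2 hG hGM
  rw [← hn] at hmain
  rw [hexp]
  refine hmain.trans ?_
  have b1 : ρ ^ n ≤ r⁻¹ * s ^ d := by
    refine le_trans ?_ (hs d)
    calc ρ ^ n ≤ r ^ n := pow_le_pow_left₀ hρ.le (le_max_left _ _) _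
      _ ≤ r ^ (d / 2) := pow_le_pow_of_le_one hr0.le hr1.le (by omega)
  have b2 : ρ' ^ (d / 2) ≤ r⁻¹ * s ^ d :=
    (pow_le_pow_left₀ hr.le (le_max_right _ _) _).trans (hs d)
  set X := r⁻¹ * s ^ d with hX
  have hX0 : 0 ≤ X := by positivity
  calc 4 * A ^ 2 * M * (B * ρ ^ n) + 4 * A * M * V * (B' * ρ' ^ (d / 2))
      ≤ 4 * A ^ 2 * M * (B * X) + 4 * A * M * V * (B' * X) := by gcongr
    -- The nonnegative cross terms are added so that the bound factors through (A + V)(B + B').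
    _ ≤ 4 * A ^ 2 * M * (B * X) + 4 * A * M * V * (B' * X) +
        (4 * A ^ 2 * M * (B' * X) + 4 * A * M * V * (B * X)) :=
        le_add_of_nonneg_right (by positivity)
    _ = A * M * (A + V) * (4 * (B + B') * r⁻¹) * s ^ d := by rw [hX]; ring

/-! ### Bounds for the observables and the correlation -/

theorem eVariationOn_sub_le (g h : ℝ → ℝ) (s : Set ℝ) :
    eVariationOn (fun x => g x - h x) s ≤ eVariationOn g s + eVariationOn h s := by
  refine iSup_le fun p => ?_
  refine le_trans ?_ (add_le_add
    (eVariationOn.sum_le (f := g) (n := p.1) p.2.2.1 p.2.2.2)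
    (eVariationOn.sum_le (f := h) (n := p.1) p.2.2.1 p.2.2.2))
  rw [← Finset.sum_add_distrib]
  refine Finset.sum_le_sum fun i _ => ?_
  rw [edist_dist, edist_dist, edist_dist, ← ENNReal.ofReal_add dist_nonneg dist_nonneg]
  refine ENNReal.ofReal_le_ofReal ?_
  rw [Real.dist_eq, Real.dist_eq, Real.dist_eq, sub_sub_sub_comm]
  exact abs_sub _ _

theorem eVariationOn_Icc_le_one_of_monotone {g : ℝ → ℝ} (hg : Monotone g) (h0 : ∀ x, 0 ≤ g x)
    (h1 : ∀ x, g x ≤ 1) : eVariationOn g (Set.Icc α β) ≤ 1 := by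
  have h := (hg.monotoneOn Set.univ).eVariationOn_eq (Set.mem_univ α) (Set.mem_univ β)
  rw [Set.univ_inter] at h
  rw [h, ← ENNReal.ofReal_one]
  exact ENNReal.ofReal_le_ofReal (by linarith [h0 α, h1 β])

/-- The indicator is a difference of two monotone steps, each of variation at most one, whatever the
centre and radius. This is the source of the uniform constant. -/
theorem eVariationOn_ballIndicator_le {x r : ℝ} (hr : 0 < r) :
    eVariationOn (ballIndicator x r) (Set.Icc α β) ≤ ENNReal.ofReal 2 := by
  classical
  have e : ballIndicator x r =
      fun y => (if x - 2 * r < y then (1 : ℝ) else 0) - if x + 2 * r ≤ y then 1 else 0 := by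
    funext y
    rw [ballIndicator, Real.ball_eq_Ioo, Set.indicator_apply]
    simp only [Set.mem_Ioo]
    split_ifs <;> first | (exfalso; grind) | norm_num
  rw [e]
  refine (eVariationOn_sub_le _ _ _).trans ?_
  have h2 : ENNReal.ofReal 2 = 1 + 1 := by rw [ENNReal.ofReal_ofNat, one_add_one_eq_two]
  rw [h2]
  refine add_le_add (eVariationOn_Icc_le_one_of_monotone ?_ ?_ ?_) (eVariationOn_Icc_le_one_of_monotone ?_ ?_ ?_)
  · intro y z hyz
    beta_reduce
    split_ifs <;> first | (exfalso; linarith) | norm_num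
  · intro y; split_ifs <;> norm_num
  · intro y; split_ifs <;> norm_num
  · intro y z hyz
    beta_reduce
    split_ifs <;> first | (exfalso; linarith) | norm_num
  · intro y; split_ifs <;> norm_num
  · intro y; split_ifs <;> norm_num

theorem abs_ballIndicator_le (x r y : ℝ) : |ballIndicator x r y| ≤ 1 := by
  classical
  rw [ballIndicator, Set.indicator_apply]
  split_ifs <;> simp

theorem exists_abs_le_of_boundedVariationOn {f : ℝ → ℝ} (hαβ : α < β)
    (hf : BoundedVariationOn f (Set.Icc α β)) : ∃ A, 0 ≤ A ∧ ∀ x ∈ Set.Icc α β, |f x| ≤ A := by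
  refine ⟨|f α| + (eVariationOn f (Set.Icc α β)).toReal, by positivity, fun x hx => ?_⟩
  have h := hf.dist_le hx (Set.left_mem_Icc.2 hαβ.le)
  rw [Real.dist_eq] at h
  have := abs_sub_abs_le_abs_sub (f x) (f α)
  linarith

theorem exists_ae_abs_le_of_memLp_top {g : ℝ → ℝ} (hg : MemLp g ⊤ μ) :
    ∃ M, 0 ≤ M ∧ ∀ᵐ x ∂μ, |g x| ≤ M := by
  refine ⟨(eLpNormEssSup g μ).toReal, ENNReal.toReal_nonneg, ?_⟩
  have htop : eLpNormEssSup g μ ≠ ∞ := by simpa using hg.eLpNorm_ne_top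
  filter_upwards [ae_le_eLpNormEssSup (f := g) (μ := μ)] with x hx
  rw [← ENNReal.ofReal_le_iff_le_toReal htop]
  rwa [← Real.norm_eq_abs, ofReal_norm]

theorem fourCorrelation_dirac {x₀ : ℝ} (h : T x₀ = x₀) (f₁ f₂ g₁ g₂ : ℝ → ℝ) (a b c : ℕ) :
    fourCorrelation T (Measure.dirac x₀) f₁ f₂ g₁ g₂ a b c = 0 := by
  have hn (n : ℕ) : T^[n] x₀ = x₀ := Function.iterate_fixed h n
  simp only [fourCorrelation, integral_dirac, hn]
  simp [mul_assoc]

/-- The two later observables merge into one bounded function evaluated at time b, which reduces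
four-fold mixing to a covariance. -/
theorem fourCorrelation_eq (f₁ f₂ g₁ g₂ : ℝ → ℝ) {a b c : ℕ} (hbc : b ≤ c) :
    fourCorrelation T μ f₁ f₂ g₁ g₂ a b c =
      |(∫ x, f₁ x * f₂ (T^[a] x) * (fun y => g₁ y * g₂ (T^[c - b] y)) (T^[b] x) ∂μ) -
        (∫ x, f₁ x * f₂ (T^[a] x) ∂μ) * ∫ x, (fun y => g₁ y * g₂ (T^[c - b] y)) x ∂μ| := by
  simp only [fourCorrelation, ← Function.iterate_add_apply, Nat.sub_add_cancel hbc, mul_assoc]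

theorem ae_abs_mul_comp_iterate_le (hT : MeasurePreserving T μ μ) {g₁ g₂ : ℝ → ℝ} {M₁ M₂ : ℝ}
    (h1 : ∀ᵐ x ∂μ, |g₁ x| ≤ M₁) (h2 : ∀ᵐ x ∂μ, |g₂ x| ≤ M₂) (n : ℕ) :
    ∀ᵐ x ∂μ, |g₁ x * g₂ (T^[n] x)| ≤ M₁ * M₂ := by
  filter_upwards [h1, (hT.iterate n).quasiMeasurePreserving.ae h2] with x hx hx'
  rw [abs_mul]
  exact mul_le_mul hx hx' (abs_nonneg _) ((abs_nonneg _).trans hx)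

end IntervalMap

/-! ### Conclusion -/

theorem lemma4p5 {ι : Type*} [Countable ι] {α β : ℝ} (hαβ : α < β) {T : ℝ → ℝ} {I : ι → Set ℝ}
    (hT : IntervalMap.IsGibbsMarkov α β T I)
    {φ : ℝ → ℝ} (hφ : IntervalMap.IsLocallyHolder α β T I φ)
    {μ : MeasureTheory.Measure ℝ} [MeasureTheory.IsProbabilityMeasure μ]
    (hμ : IntervalMap.IsGibbsMeasure α β T I φ μ) (hmix : IntervalMap.IsMixing T μ) :
    ∃ κ : ℝ, 0 < κ ∧
      (∀ f₁ f₂ g₁ g₂ : ℝ → ℝ,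
        BoundedVariationOn f₁ (Set.Icc α β) → BoundedVariationOn f₂ (Set.Icc α β) →
        MeasureTheory.MemLp g₁ ⊤ μ → MeasureTheory.MemLp g₂ ⊤ μ →
        ∃ C : ℝ, 0 < C ∧ ∀ a b c : ℕ, a < b → b ≤ c →
          IntervalMap.fourCorrelation T μ f₁ f₂ g₁ g₂ a b c ≤
            C * Real.exp (-κ * ((b : ℝ) - a))) ∧
      (∃ C : ℝ, 0 < C ∧ ∀ r : ℝ, 0 < r → ∀ x ∈ Set.Icc α β, ∀ y ∈ Set.Icc α β,
        ∀ a b c : ℕ, a < b → b ≤ c →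
          IntervalMap.fourCorrelation T μ
            (IntervalMap.ballIndicator x r) (IntervalMap.ballIndicator y r)
            (IntervalMap.ballIndicator x r) (IntervalMap.ballIndicator y r) a b c ≤
            C * Real.exp (-κ * ((b : ℝ) - a))) := by
  -- If one element has full measure, the decay of cylinders is not available; μ is then a Dirac
  -- mass at a fixed point.
  by_cases hone : ∃ k, μ (I k) = 1
  · obtain ⟨k, hk⟩ := hone
    obtain ⟨x₀, hx₀, hfix⟩ := IntervalMap.exists_eq_dirac_of_measure_eq_one
      hT.toIsPiecewiseExpanding hT.injective hμ hmix hk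
    refine ⟨1, one_pos, fun f₁ f₂ g₁ g₂ _ _ _ _ => ⟨1, one_pos, fun a b c _ _ => ?_⟩,
      1, one_pos, fun r _ x _ y _ a b c _ _ => ?_⟩ <;>
    · rw [hx₀, IntervalMap.fourCorrelation_dirac hfix]
      positivity
  push Not at hone
  obtain ⟨κ, K, hκ, hK, h⟩ := IntervalMap.exists_exponential_decorrelation hT hφ hμ hmix hone
  -- With A = M = 1 and V = 2 the factor A·M·(A + V)·K equals 3K; the added 1 only ensures
  -- positivity.
  refine ⟨κ, hκ, fun f₁ f₂ g₁ g₂ hf₁ hf₂ hg₁ hg₂ => ?_, 3 * K + 1, by positivity,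
    fun r hr x _ y _ a b c hab hbc => ?_⟩
  · obtain ⟨A₁, hA₁, h₁⟩ := IntervalMap.exists_abs_le_of_boundedVariationOn hαβ hf₁
    obtain ⟨A₂, hA₂, h₂⟩ := IntervalMap.exists_abs_le_of_boundedVariationOn hαβ hf₂
    obtain ⟨M₁, hM₁, b₁⟩ := IntervalMap.exists_ae_abs_le_of_memLp_top hg₁
    obtain ⟨M₂, hM₂, b₂⟩ := IntervalMap.exists_ae_abs_le_of_memLp_top hg₂
    set A := max A₁ A₂ with hA
    set V := max (eVariationOn f₁ (Set.Icc α β)).toReal (eVariationOn f₂ (Set.Icc α β)).toReal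
      with hV
    have hA0 : 0 ≤ A := le_max_of_le_left hA₁
    have hV0 : 0 ≤ V := le_max_of_le_left ENNReal.toReal_nonneg
    refine ⟨A * (M₁ * M₂) * (A + V) * K + 1, by positivity, fun a b c hab hbc => ?_⟩
    rw [IntervalMap.fourCorrelation_eq _ _ _ _ hbc]
    refine (h A V (M₁ * M₂) hA0 hV0 (by positivity) f₁ f₂ _
      (fun x hx => (h₁ x hx).trans (le_max_left _ _))
      (fun x hx => (h₂ x hx).trans (le_max_right _ _))
      ((ENNReal.le_ofReal_iff_toReal_le hf₁ hV0).2 (le_max_left _ _))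
      ((ENNReal.le_ofReal_iff_toReal_le hf₂ hV0).2 (le_max_right _ _))
      (hg₁.aestronglyMeasurable.aemeasurable.mul
        (hg₂.aestronglyMeasurable.aemeasurable.comp_quasiMeasurePreserving
          (hμ.invariant.iterate _).quasiMeasurePreserving))
      (IntervalMap.ae_abs_mul_comp_iterate_le hμ.invariant b₁ b₂ _) a b hab).trans ?_
    gcongr
    linarith
  · have hmeas (z : ℝ) : Measurable (IntervalMap.ballIndicator z r) :=
      measurable_const.indicator Metric.isOpen_ball.measurableSet
    have habs (z w : ℝ) : |IntervalMap.ballIndicator z r w| ≤ 1 :=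
      IntervalMap.abs_ballIndicator_le z r w
    rw [IntervalMap.fourCorrelation_eq _ _ _ _ hbc]
    refine (h 1 2 (1 * 1) zero_le_one zero_le_two (by norm_num) _ _ _ (fun z _ => habs x z)
      (fun z _ => habs y z)
      (IntervalMap.eVariationOn_ballIndicator_le hr) (IntervalMap.eVariationOn_ballIndicator_le hr)
      ((hmeas x).mul ((hmeas y).comp (hμ.invariant.measurable.iterate _))).aemeasurable
      (IntervalMap.ae_abs_mul_comp_iterate_le hμ.invariant (Filter.Eventually.of_forall (habs x))
        (Filter.Eventually.of_forall (habs y)) _) a b hab).trans ?_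
    gcongr
    linarith
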